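/- **Setting.** Let $G_\infty=(V,E)$ be an infinite, locally finite, connected graph (multiple edges and self-loops allowed), $d$ its graph distance, $B(x,R)$ its closed balls, and let $G_0\subseteq G_1\subseteq\cdots$ be subgraphs of $G_\infty$ whose edge sets $E_t$ increase to $E$. Let $V_t$ be the set of vertices joined in $G_t$ to some other vertex; assume that $V_t$ is finite and that $(V_t,E_t)$ is connected. Let $\pi^{(t)}(x,y)$ be the number of edges of $G_t$ between $x$ and $y$, $\pi^{(t)}(x)=\sum_y\pi^{(t)}(x,y)$, $\pi^{(t)}(A)=\sum_{x\in A}\pi^{(t)}(x)$, $v(t)=\pi^{(t)}(V_t)$, define $\pi^{(\infty)}$ in the same way from $G_\infty$, write $v(B)=\pi^{(\infty)}(B)$ for a ball $B$, and let $$\Phi_t=\min\Big\{\frac{\pi^{(t)}(A,V_t\setminus A)}{\pi^{(t)}(A)}:\ \emptyset\ne A\subseteq V_t,\ \pi^{(t)}(A)\le \tfrac{v(t)}2\Big\},\qquad \pi^{(t)}(A,B)=\sum_{x\in A,\,y\in B}\pi^{(t)}(x,y).$$ Fix $x_0\in V_0$. Let $(X_t)_{t\in\mathbb N}$ be the Markov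 chain with $X_0=x_0$ and $\mathbb P(X_{t+1}=y\mid X_t=x)=\pi^{(t)}(x,y)/\pi^{(t)}(x)$ for $x,y\in V_t$, and put $P(0,x_0;t,y)=\mathbb P(X_t=y)$. The chain is *weakly recurrent* if $\mathbb E\big[\sum_{t\ge0}1_{\{X_t=x_0\}}\big]=\infty$. For $\psi:(0,\infty)\to(0,\infty)$ continuous and non-decreasing, $G_\infty$ satisfies LLE($\psi$) if for every $\delta\in(0,1)$ there is $c_{\rm HK}(\delta)>0$ such that for all real $m\ge1$ and all $x,y\in B(x_0,(1-\delta)m)\setminus\partial B(x_0,m)$, $$\mathbb P_x\big(Y_{\lfloor\psi(m)\rfloor}=y,\ \lfloor\psi(m)\rfloor<\tau\big)\ \ge\ \frac{c_{\rm HK}(\delta)}{v(B(x_0,m))},$$ where $Y$ is simple random walk on $G_\infty$, $\partial B(x_0,m)$ is the set of vertices of $B(x_0,m)$ that have a $G_\infty$-neighbour outside $B(x_0,m)$, and $\tau\ge0$ is the first hitting time of $\partial B(x_0,m)$ by $Y$. **Proposition.** Assume that 1. for some $\gamma\in(0,\frac12]$ and $\Delta<\infty$, $\pi^{(t)}(x,x)\ge\gamma\,\pi^{(t)}(x)$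 and $\pi^{(t)}(x)\le\Delta$ for all $t$ and $x\in V_t$; 2. $v(B(x,2R))\le D_1v(B(x,R))$ for all $x\in V$, $R>0$, and $G_\infty$ satisfies LLE($\psi$) with constants $c_{\rm HK}(\cdot)$; 3. there is a continuous non-decreasing $r:[0,\infty)\to(0,\infty)$ such that for every $t\in\mathbb N$ the graph $G_t$ contains the ball $B(x_0,r(t))$ together with all edges of $G_\infty$ between its vertices, and $\big(v(t)-v(B(x_0,r(t)))\big)/v(t)\to0$ as $t\to\infty$; 4. $\displaystyle\liminf_{t\to\infty}\ \frac{\sum_{u=\lfloor t/2\rfloor}^{t-1}\Phi_u^2}{\log v(\lfloor t/2\rfloor)}\ \ge\ \zeta$ for some real $\zeta>0$; 5. $v(2t)\le D_2v(t)$ for all integers $t\ge1$. Put $r^{-1}(m)=\inf\{s\ge0:r(s)\ge m\}$ and $(r^{-1}+\psi)^{-1}(t)=\sup\{m>0:r^{-1}(m)+\psi(m)\le t\}$ (and $0$ if there is no such $m$). Then there are $\delta_0\in(0,\frac12]$ depending only on $\gamma,\Delta,\zeta,D_1,D_2$, and $c>0$ depending only on these and on $c_{\rm HK}(\cdot)$,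 with the following properties. * There is $t_0$ (which may depend on the whole sequence of graphs) such that for all integers $t\ge t_0$ and all $y\in V_t$ with $d(x_0,y)\le(1-\delta_0)(r^{-1}+\psi)^{-1}(t)$, $$P(0,x_0;t,y)\ \ge\ \frac{c}{v(t)} .$$ * The same bound holds for all integers $t\ge2$ and all such $y$ if $c$ is replaced by some $c'>0$ that may depend on the whole sequence of graphs. * If $\sum_{t}1/v(t)=\infty$, then $(X_t)$ is weakly recurrent. -/

import Mathlib

/-- An undirected graph on the vertex type `V`, multiple edges and self-loops allowed, recorded by
the number `mult x y` of edges joining `x` and `y` (`mult x x` is the number of loops at `x`). -/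
structure MultiGraph (V : Type*) where
  mult : V → V → ℕ
  symm : ∀ x y, mult x y = mult y x

namespace MultiGraph

variable {V : Type*}

/-- The underlying simple graph, used for connectedness and for the graph distance. -/
def toSimple (G : MultiGraph V) : SimpleGraph V where
  Adj x y := x ≠ y ∧ G.mult x y ≠ 0
  symm := ⟨fun x y h => ⟨h.1.symm, by rw [G.symm y x]; exact h.2⟩⟩
  loopless := ⟨fun _ h => h.1 rfl⟩

/-- The set of non-isolated vertices: those joined to some other vertex. -/
def verts (G : MultiGraph V) : Set V := {x | ∃ y, y ≠ x ∧ G.mult x y ≠ 0}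

/-- `π(x)`: the number of edges at `x`, each loop counted once. -/
noncomputable def degree (G : MultiGraph V) (x : V) : ℕ := ∑ᶠ y, G.mult x y

/-- `π(A) = ∑_{x ∈ A} π(x)`, for finite `A`. -/
noncomputable def volume (G : MultiGraph V) (A : Set V) : ℝ := ∑ᶠ x ∈ A, (G.degree x : ℝ)

/-- `π(A, B) = ∑_{x ∈ A, y ∈ B} π(x, y)`, for finite `A`, `B`. -/
noncomputable def edgeCount (G : MultiGraph V) (A B : Set V) : ℝ :=
  ∑ᶠ x ∈ A, ∑ᶠ y ∈ B, (G.mult x y : ℝ)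

/-- The volume `v = π(V_G)` of a finite graph, `V_G` being the non-isolated vertices. -/
noncomputable def totalVolume (G : MultiGraph V) : ℝ := G.volume G.verts

/-- The Cheeger constant: the infimum of `π(A, V_G \ A) / π(A)` over the nonempty `A ⊆ V_G` with
`π(A) ≤ v / 2`. (Such `A` exist for a finite graph with a non-loop edge: a vertex of least
degree.) -/
noncomputable def cheeger (G : MultiGraph V) : ℝ :=
  sInf {a : ℝ | ∃ A : Set V, A ⊆ G.verts ∧ A.Nonempty ∧ G.volume A ≤ G.totalVolume / 2 ∧
    a = G.edgeCount A (G.verts \ A) / G.volume A}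

/-- One-step transition probability of simple random walk. -/
noncomputable def step (G : MultiGraph V) (x y : V) : ℝ := (G.mult x y : ℝ) / (G.degree x : ℝ)

/-- The closed ball of (real) radius `R` in the graph distance of `G`. -/
def ball (G : MultiGraph V) (x : V) (R : ℝ) : Set V := {y | (G.toSimple.dist x y : ℝ) ≤ R}

/-- The inner boundary of `H` relative to `G`. -/
def innerBoundary (G : MultiGraph V) (H : Set V) : Set V :=
  {x | x ∈ H ∧ ∃ y, y ∉ H ∧ G.mult x y ≠ 0}

open Classical in
/-- `killed S k x y = P_x(Y_k = y, k < τ)`, for simple random walk `Y` on `G` and `τ ≥ 0` the first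
time that `Y` is in `S`. -/
noncomputable def killed (G : MultiGraph V) (S : Set V) : ℕ → V → V → ℝ
  | 0, x, y => if x = y ∧ y ∉ S then 1 else 0
  | k + 1, x, y => if y ∈ S then 0 else ∑ᶠ z, G.killed S k x z * G.step z y

/-- Volume doubling with constant `D`, for all centres and all radii. -/
def VolumeDoubling (G : MultiGraph V) (D : ℝ) : Prop :=
  ∀ (x : V) (R : ℝ), 0 < R → G.volume (G.ball x (2 * R)) ≤ D * G.volume (G.ball x R)

/-- The local lower estimate LLE(ψ) around `x₀`, with constants `cHK δ`, `δ ∈ (0, 1)`: the walk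
killed on the inner boundary of `B(x₀, m)` satisfies `p_{ψ(m)}(x, y) ≥ cHK δ / v(B(x₀, m))` for all
real `m ≥ 1` and `x, y ∈ B(x₀, (1 - δ) m)`. Times are rounded down. Points of the inner boundary
itself, where the killed kernel is identically zero, are left out; they occur only if `m` is not an
integer and `δ m < 1`. -/
def LLE (G : MultiGraph V) (x₀ : V) (ψ cHK : ℝ → ℝ) : Prop :=
  ∀ δ : ℝ, 0 < δ → δ < 1 → ∀ m : ℝ, 1 ≤ m →
    ∀ x ∈ G.ball x₀ ((1 - δ) * m) \ G.innerBoundary (G.ball x₀ m),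
    ∀ y ∈ G.ball x₀ ((1 - δ) * m) \ G.innerBoundary (G.ball x₀ m),
      cHK δ / G.volume (G.ball x₀ m) ≤
        G.killed (G.innerBoundary (G.ball x₀ m)) ⌊ψ m⌋₊ x y

end MultiGraph

/-- A sequence of finite connected graphs `graph 0 ⊆ graph 1 ⊆ ...` (connected on their
non-isolated vertices) that increases to a locally finite connected graph `limit`. -/
structure GrowingGraph (V : Type*) where
  limit : MultiGraph V
  graph : ℕ → MultiGraph V
  locallyFinite : ∀ x, {y | limit.mult x y ≠ 0}.Finite
  limit_connected : limit.toSimple.Connected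
  mono : ∀ t x y, (graph t).mult x y ≤ (graph (t + 1)).mult x y
  le_limit : ∀ t x y, (graph t).mult x y ≤ limit.mult x y
  exhausts : ∀ x y, ∃ t, (graph t).mult x y = limit.mult x y
  finite_verts : ∀ t, (graph t).verts.Finite
  connected : ∀ t, ∀ x ∈ (graph t).verts, ∀ y ∈ (graph t).verts,
    (graph t).toSimple.Reachable x y

namespace GrowingGraph

variable {V : Type*}

/-- `V_t`. -/
def verts (𝒢 : GrowingGraph V) (t : ℕ) : Set V := (𝒢.graph t).verts

/-- `v(t)`. -/
noncomputable def vol (𝒢 : GrowingGraph V) (t : ℕ) : ℝ := (𝒢.graph t).totalVolume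

open Classical in
/-- `P(0, x₀; t, y)`: the `t`-step transition probability of the walk whose step from time `u` to
time `u + 1` is a simple random walk step on `graph u`. -/
noncomputable def transProb (𝒢 : GrowingGraph V) (x₀ : V) : ℕ → V → ℝ
  | 0, y => if y = x₀ then 1 else 0
  | t + 1, y => ∑ᶠ z, 𝒢.transProb x₀ t z * (𝒢.graph t).step z y

/-- Uniform `γ`-laziness of the walk. -/
def Lazy (𝒢 : GrowingGraph V) (γ : ℝ) : Prop :=
  ∀ t, ∀ x ∈ 𝒢.verts t, γ ≤ (𝒢.graph t).step x x

/-- Uniformly bounded degrees. -/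
def DegreeBound (𝒢 : GrowingGraph V) (Δ : ℝ) : Prop :=
  ∀ t, ∀ x ∈ 𝒢.verts t, ((𝒢.graph t).degree x : ℝ) ≤ Δ

/-- The ball-like condition: `graph t` contains the ball `B(x₀, r(t))` of the limit graph with all
the edges that the limit graph has inside this ball, and `(v(t) - v(B(x₀, r(t)))) / v(t) → 0`, where
the volume of a ball is taken in the limit graph. -/
structure BallLike (𝒢 : GrowingGraph V) (x₀ : V) (r : ℝ → ℝ) : Prop where
  continuousOn : ContinuousOn r (Set.Ici 0)
  monotoneOn : MonotoneOn r (Set.Ici 0)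
  pos : ∀ s, 0 ≤ s → 0 < r s
  ball_subset : ∀ t : ℕ, 𝒢.limit.ball x₀ (r t) ⊆ 𝒢.verts t
  ball_induced : ∀ t : ℕ, ∀ x ∈ 𝒢.limit.ball x₀ (r t), ∀ y ∈ 𝒢.limit.ball x₀ (r t),
    (𝒢.graph t).mult x y = 𝒢.limit.mult x y
  tendsto : Filter.Tendsto
    (fun t : ℕ => (𝒢.vol t - 𝒢.limit.volume (𝒢.limit.ball x₀ (r t))) / 𝒢.vol t)
    Filter.atTop (nhds 0)

/-- The regularity condition: the lower limit of
`∑_{u = ⌊t/2⌋}^{t - 1} Φ_u ^ 2 / log v(⌊t/2⌋)` (possibly `+∞`) is at least `ζ`. -/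
def Regular (𝒢 : GrowingGraph V) (ζ : ℝ) : Prop :=
  (ζ : EReal) ≤ Filter.liminf (fun t : ℕ =>
    (((∑ u ∈ Finset.Ico (t / 2) t, (𝒢.graph u).cheeger ^ 2) / Real.log (𝒢.vol (t / 2)) : ℝ) :
      EReal)) Filter.atTop

/-- `t ↦ v(t)` is doubling with constant `D`. -/
def VolDoubling (𝒢 : GrowingGraph V) (D : ℝ) : Prop :=
  ∀ t : ℕ, 1 ≤ t → 𝒢.vol (2 * t) ≤ D * 𝒢.vol t

/-- `X` is a simple random walk on the growing graph started at `x₀`: a process with `X_0 = x₀`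
almost surely which, given the past up to time `t` and `X_t = x`, jumps to `y` with probability
`π^{(t)}(x, y) / π^{(t)}(x)`. -/
structure IsWalk (𝒢 : GrowingGraph V) (x₀ : V) {Ω : Type*} [MeasurableSpace Ω]
    (μ : MeasureTheory.Measure Ω) (X : ℕ → Ω → V) : Prop where
  measurable : ∀ t, @Measurable Ω V _ ⊤ (X t)
  start : ∀ᵐ ω ∂μ, X 0 ω = x₀
  markov : ∀ (t : ℕ) (A : Set Ω),
    @MeasurableSet Ω (⨆ i : ℕ, ⨆ _ : i ≤ t, MeasurableSpace.comap (X i) ⊤) A →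
    ∀ x ∈ 𝒢.verts t, ∀ y : V,
      μ (A ∩ {ω | X t ω = x} ∩ {ω | X (t + 1) ω = y}) =
        μ (A ∩ {ω | X t ω = x}) * ENNReal.ofReal ((𝒢.graph t).step x y)

end GrowingGraph

/-- Weak recurrence: the expected number of visits of `X` to its starting point is infinite. -/
def WeaklyRecurrent {V Ω : Type*} [MeasurableSpace Ω] (μ : MeasureTheory.Measure Ω)
    (X : ℕ → Ω → V) (x₀ : V) : Prop :=
  ∫⁻ ω, ∑' t : ℕ, Set.indicator {ω' | X t ω' = x₀} (fun _ => (1 : ENNReal)) ω ∂μ = ⊤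

/-- The generalized inverse `r⁻¹(m) = inf {s ≥ 0 : r(s) ≥ m}` of a non-decreasing function on
`[0, ∞)`. -/
noncomputable def genInv (r : ℝ → ℝ) (m : ℝ) : ℝ := sInf {s : ℝ | 0 ≤ s ∧ m ≤ r s}

/-- `(r⁻¹ + ψ)⁻¹(t) = sup {m > 0 : r⁻¹(m) + ψ(m) ≤ t}` (and `0` if there is no such `m`). -/
noncomputable def reach (r ψ : ℝ → ℝ) (t : ℝ) : ℝ := sSup {m : ℝ | 0 < m ∧ genInv r m + ψ m ≤ t}

/-!
The isoperimetric ratio `Φ_t` controls the Dirichlet form: integrating the level-set inequality over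
all truncations `(f - a)⁺` (coarea formula, Cheeger's argument) gives a Nash-type inequality, by
which the energy `∑ y, P(0, x₀; t, y)² / π_t(y)` is multiplied by a factor `1 - c Φ_t²` at every
step until it is of order `1 / v`. By hypothesis 4, boundedly many dyadic time intervals before `t`
suffice for this, so the energy at time `t` is at most `C / v(t)`. Volume doubling shows that a thin
annulus at the boundary of `B(x₀, r(t))` has a small share of the volume, and by Cauchy–Schwarz also
a small share of the walk: half of its mass lies in `B(x₀, θ r(t))` for some `θ < 1`.

Given `t`, choose `s` with `s + ψ(m) = t`, where `m = (1 - δ) r(s)`. After time `s` the walk inside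
`B(x₀, m)` only sees the limit graph, hence dominates the killed walk there, and `LLE(ψ)` carries
the half mass at time `s` to every vertex close enough to `x₀` at time `t`. At `y = x₀` this bounds
the expected number of returns below by a multiple of `∑ 1 / v(t)`.
-/

/-- A finite electrical network: symmetric non-negative conductances `weight x y` between the points
of the finite set `carrier`. Weights of pairs outside `carrier` never enter. -/
structure FiniteNetwork (V : Type*) where
  carrier : Finset V
  weight : V → V → ℝ
  symm : ∀ x y, weight x y = weight y x
  nonneg : ∀ x y, 0 ≤ weight x y

namespace FiniteNetwork

variable {V : Type*} (N : FiniteNetwork V)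

/-- The total weight at `x`, which is the reversible measure of the random walk. -/
def degree (x : V) : ℝ := ∑ y ∈ N.carrier, N.weight x y

/-- The reversible measure of a finite set. -/
def volume (S : Finset V) : ℝ := ∑ x ∈ S, N.degree x

/-- The integral against the reversible measure. -/
def integral (f : V → ℝ) : ℝ := ∑ x ∈ N.carrier, N.degree x * f x

/-- The `L¹` norm of the discrete gradient, each unordered pair being counted twice. -/
def totalVariation (f : V → ℝ) : ℝ :=
  ∑ x ∈ N.carrier, ∑ y ∈ N.carrier, N.weight x y * |f x - f y|

/-- The squared `L²` norm of the discrete gradient, each unordered pair being counted twice. -/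
def dirichletForm (f : V → ℝ) : ℝ :=
  ∑ x ∈ N.carrier, ∑ y ∈ N.carrier, N.weight x y * (f x - f y) ^ 2

/-- The Markov operator: the mean of `f` over a random walk step from `x`. -/
noncomputable def average (f : V → ℝ) (x : V) : ℝ :=
  (∑ y ∈ N.carrier, N.weight x y * f y) / N.degree x

/-- The total weight between `S` and its complement in the network. -/
def cut [DecidableEq V] (S : Finset V) : ℝ := ∑ x ∈ S, ∑ y ∈ N.carrier \ S, N.weight x y

/-- `Φ` is an isoperimetric constant for the sets of volume at most `B`. -/
def IsIsoperimetric [DecidableEq V] (Φ B : ℝ) : Prop :=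
  ∀ S ⊆ N.carrier, N.volume S ≤ B → Φ * N.volume S ≤ N.cut S

variable {N}

theorem degree_nonneg (x : V) : 0 ≤ N.degree x := Finset.sum_nonneg fun y _ => N.nonneg x y

theorem integral_nonneg {f : V → ℝ} (hf : ∀ x, 0 ≤ f x) : 0 ≤ N.integral f :=
  Finset.sum_nonneg fun x _ => mul_nonneg (degree_nonneg x) (hf x)

theorem totalVariation_nonneg (f : V → ℝ) : 0 ≤ N.totalVariation f :=
  Finset.sum_nonneg fun x _ => Finset.sum_nonneg fun y _ => mul_nonneg (N.nonneg x y) (abs_nonneg _)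

theorem dirichletForm_nonneg (f : V → ℝ) : 0 ≤ N.dirichletForm f :=
  Finset.sum_nonneg fun x _ => Finset.sum_nonneg fun y _ => mul_nonneg (N.nonneg x y) (sq_nonneg _)

theorem sum_sum_weight_mul_left (f : V → ℝ) :
    ∑ x ∈ N.carrier, ∑ y ∈ N.carrier, N.weight x y * f x = N.integral f :=
  Finset.sum_congr rfl fun _ _ => by rw [degree, Finset.sum_mul]

theorem sum_sum_weight_mul_right (f : V → ℝ) :
    ∑ x ∈ N.carrier, ∑ y ∈ N.carrier, N.weight x y * f y = N.integral f := by
  rw [Finset.sum_comm, ← sum_sum_weight_mul_left]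
  exact Finset.sum_congr rfl fun x _ => Finset.sum_congr rfl fun y _ => by rw [N.symm]

section Coarea

variable [DecidableEq V] {S : Finset V}

theorem integral_indicator (hS : S ⊆ N.carrier) (a : ℝ) :
    N.integral (fun x => if x ∈ S then a else 0) = a * N.volume S := by
  rw [integral, volume, Finset.mul_sum]
  refine (Finset.sum_subset hS fun x _ hx => ?_).symm.trans (Finset.sum_congr rfl fun x hx => ?_)
  · rw [if_neg hx, mul_zero]
  · rw [if_pos hx, mul_comm]

theorem totalVariation_indicator (hS : S ⊆ N.carrier) {a : ℝ} (ha : 0 ≤ a) :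
    N.totalVariation (fun x => if x ∈ S then a else 0) = 2 * (a * N.cut S) := by
  have split (x : V) : ∑ y ∈ N.carrier,
        N.weight x y * |(if x ∈ S then a else 0) - if y ∈ S then a else 0| =
      if x ∈ S then a * ∑ y ∈ N.carrier \ S, N.weight x y else a * ∑ y ∈ S, N.weight x y := by
    rw [← Finset.sum_sdiff hS,
      Finset.sum_congr rfl fun y hy => by rw [if_neg (Finset.mem_sdiff.1 hy).2],
      Finset.sum_congr (s₁ := S) rfl fun y hy => by rw [if_pos hy]]
    by_cases hx : x ∈ S <;> simp [hx, abs_of_nonneg ha, Finset.mul_sum, mul_comm]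
  have hswap : ∑ x ∈ N.carrier \ S, ∑ y ∈ S, N.weight x y = N.cut S := by
    rw [cut, Finset.sum_comm]
    exact Finset.sum_congr rfl fun x _ => Finset.sum_congr rfl fun y _ => N.symm y x
  simp only [totalVariation, split]
  rw [← Finset.sum_sdiff hS,
    Finset.sum_congr rfl fun x hx => if_neg (Finset.mem_sdiff.1 hx).2,
    Finset.sum_congr (s₁ := S) rfl fun x hx => if_pos hx, ← Finset.mul_sum, ← Finset.mul_sum,
    hswap, cut]
  ring

theorem totalVariation_eq_add_of_le {g : V → ℝ} {a : ℝ} (ha : 0 ≤ a) (hg : ∀ x ∈ S, a ≤ g x)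
    (hgS : ∀ x ∈ N.carrier, x ∉ S → g x = 0) :
    N.totalVariation g = N.totalVariation (fun x => if x ∈ S then a else 0) +
      N.totalVariation (fun x => g x - if x ∈ S then a else 0) := by
  simp only [totalVariation, ← Finset.sum_add_distrib, ← mul_add]
  refine Finset.sum_congr rfl fun x hxN => Finset.sum_congr rfl fun y hyN => congrArg _ ?_
  have habs (z : V) (hz : z ∈ S) : |g z| = |a| + |g z - a| := by
    rw [abs_of_nonneg ha, abs_of_nonneg (ha.trans (hg z hz)),
      abs_of_nonneg (sub_nonneg.2 (hg z hz)), add_sub_cancel]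
  by_cases hx : x ∈ S <;> by_cases hy : y ∈ S <;>
    simp only [hx, hy, hgS x hxN, hgS y hyN, if_true, if_false, not_false_eq_true, sub_zero,
      zero_sub, sub_self, abs_zero, abs_neg, zero_add, sub_sub_sub_cancel_right, habs]

theorem IsIsoperimetric.two_mul_integral_le_totalVariation {Φ B : ℝ}
    (hΦ : N.IsIsoperimetric Φ B) (hS : S ⊆ N.carrier) (hB : N.volume S ≤ B) {g : V → ℝ}
    (hg : ∀ x, 0 ≤ g x) (hgS : ∀ x ∈ N.carrier, x ∉ S → g x = 0) :
    2 * (Φ * N.integral g) ≤ N.totalVariation g := by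
  induction S using Finset.strongInduction generalizing g with
  | H S ih =>
    rcases S.eq_empty_or_nonempty with rfl | hne
    · have hint : N.integral g = 0 :=
        Finset.sum_eq_zero fun x hx => by rw [hgS x hx (Finset.notMem_empty x), mul_zero]
      rw [hint, mul_zero, mul_zero]
      exact totalVariation_nonneg g
    -- Peel off the lowest layer `min g • 1_S`, which removes a point from the support.
    obtain ⟨x₁, hx₁, hmin⟩ := S.exists_min_image g hne
    set layer : V → ℝ := fun x => if x ∈ S then g x₁ else 0 with hlayer
    have hrest : 2 * (Φ * N.integral fun x => g x - layer x) ≤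
        N.totalVariation fun x => g x - layer x := by
      refine ih (S.erase x₁) (Finset.erase_ssubset hx₁) ((Finset.erase_subset _ _).trans hS)
        ((Finset.sum_le_sum_of_subset_of_nonneg (Finset.erase_subset _ _)
          fun x _ _ => degree_nonneg x).trans hB) (fun x => ?_) fun x hxN hx => ?_
      · by_cases hxS : x ∈ S
        · simpa [hlayer, hxS] using hmin x hxS
        · simpa [hlayer, hxS] using hg x
      · by_cases hxS : x ∈ S
        · obtain rfl : x = x₁ := by simpa [hxS] using hx
          simp [hlayer, hxS]
        · simp [hlayer, hxS, hgS x hxN hxS]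
    have hsum : N.integral g = N.integral layer + N.integral fun x => g x - layer x := by
      simp only [integral, ← Finset.sum_add_distrib, ← mul_add, add_sub_cancel]
    have hcut := mul_le_mul_of_nonneg_left (hΦ S hS hB) (hg x₁)
    rw [hsum, totalVariation_eq_add_of_le (hg x₁) hmin hgS, integral_indicator hS,
      totalVariation_indicator hS (hg x₁)]
    linarith

end Coarea

theorem totalVariation_sq_sq_le (h : V → ℝ) :
    N.totalVariation (h ^ 2) ^ 2 ≤ N.dirichletForm h * (4 * N.integral (h ^ 2)) := by
  have hadd : ∑ x ∈ N.carrier, ∑ y ∈ N.carrier, N.weight x y * (h x + h y) ^ 2 ≤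
      4 * N.integral (h ^ 2) :=
    calc _ ≤ ∑ x ∈ N.carrier, ∑ y ∈ N.carrier,
          (2 * (N.weight x y * (h ^ 2) x) + 2 * (N.weight x y * (h ^ 2) y)) := by
          refine Finset.sum_le_sum fun x _ => Finset.sum_le_sum fun y _ => ?_
          simp only [Pi.pow_apply]
          linarith [mul_nonneg (N.nonneg x y) (sq_nonneg (h x - h y))]
      _ = 4 * N.integral (h ^ 2) := by
          simp only [Finset.sum_add_distrib, ← Finset.mul_sum, sum_sum_weight_mul_left,
            sum_sum_weight_mul_right]
          ring
  refine le_trans ?_ (mul_le_mul_of_nonneg_left hadd (dirichletForm_nonneg h))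
  simp only [totalVariation, dirichletForm, ← Finset.sum_product']
  refine Finset.sum_sq_le_sum_mul_sum_of_sq_le_mul _
    (fun z _ => mul_nonneg (N.nonneg _ _) (sq_nonneg _))
    (fun z _ => mul_nonneg (N.nonneg _ _) (sq_nonneg _)) fun z _ => le_of_eq ?_
  rw [mul_pow, sq_abs]
  simp only [Pi.pow_apply]
  ring

theorem IsIsoperimetric.cheeger_inequality [DecidableEq V] {Φ B : ℝ}
    (hΦ : N.IsIsoperimetric Φ B) (hΦ0 : 0 ≤ Φ) {S : Finset V} (hS : S ⊆ N.carrier)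
    (hB : N.volume S ≤ B) {h : V → ℝ} (hhS : ∀ x ∈ N.carrier, x ∉ S → h x = 0) :
    Φ ^ 2 * N.integral (h ^ 2) ≤ N.dirichletForm h := by
  have hI : 0 ≤ N.integral (h ^ 2) := integral_nonneg fun x => sq_nonneg (h x)
  have hsq : (2 * (Φ * N.integral (h ^ 2))) ^ 2 ≤ N.dirichletForm h * (4 * N.integral (h ^ 2)) :=
    (pow_le_pow_left₀ (by positivity) (hΦ.two_mul_integral_le_totalVariation hS hB
      (fun x => sq_nonneg (h x)) fun x hxN hx => by simp [hhS x hxN hx]) 2).trans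
      (totalVariation_sq_sq_le h)
  rcases hI.eq_or_lt with h0 | hpos
  · rw [← h0, mul_zero]
    exact dirichletForm_nonneg h
  · exact le_of_mul_le_mul_right (by linarith) (by linarith : 0 < 4 * N.integral (h ^ 2))

theorem dirichletForm_max_sub_le (f : V → ℝ) (a : ℝ) :
    N.dirichletForm (fun x => max (f x - a) 0) ≤ N.dirichletForm f := by
  refine Finset.sum_le_sum fun x _ => Finset.sum_le_sum fun y _ =>
    mul_le_mul_of_nonneg_left (sq_le_sq.2 ?_) (N.nonneg x y)
  simpa using abs_max_sub_max_le_abs (f x - a) (f y - a) 0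

theorem integral_sq_le_integral_max_sub_sq_add {f : V → ℝ} (hf : ∀ x, 0 ≤ f x) {a : ℝ}
    (ha : 0 ≤ a) :
    N.integral (f ^ 2) ≤ N.integral ((fun x => max (f x - a) 0) ^ 2) + 2 * a * N.integral f := by
  simp only [integral, Finset.mul_sum, ← Finset.sum_add_distrib, Pi.pow_apply]
  refine Finset.sum_le_sum fun x _ => ?_
  have hpt : f x ^ 2 ≤ max (f x - a) 0 ^ 2 + 2 * a * f x := by
    rcases le_total (f x) a with h | h
    · rw [max_eq_right (sub_nonpos.2 h)]
      nlinarith [hf x]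
    · rw [max_eq_left (sub_nonneg.2 h)]
      nlinarith
  linarith [mul_le_mul_of_nonneg_left hpt (degree_nonneg (N := N) x)]

theorem mul_volume_superlevel_le_integral {f : V → ℝ} (hf : ∀ x, 0 ≤ f x) (a : ℝ) :
    a * N.volume {x ∈ N.carrier | a < f x} ≤ N.integral f := by
  rw [volume, Finset.mul_sum]
  calc _ ≤ ∑ x ∈ N.carrier with a < f x, N.degree x * f x := by
        refine Finset.sum_le_sum fun x hx => ?_
        rw [mul_comm]
        exact mul_le_mul_of_nonneg_left (Finset.mem_filter.1 hx).2.le (degree_nonneg x)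
    _ ≤ N.integral f := Finset.sum_le_sum_of_subset_of_nonneg (Finset.filter_subset _ _)
        fun x _ _ => mul_nonneg (degree_nonneg x) (hf x)

theorem IsIsoperimetric.nash_inequality [DecidableEq V] {Φ B : ℝ} (hΦ : N.IsIsoperimetric Φ B)
    (hΦ0 : 0 ≤ Φ) {f : V → ℝ} (hf : ∀ x, 0 ≤ f x) {a : ℝ} (ha : 0 < a)
    (haB : N.integral f ≤ a * B) :
    Φ ^ 2 * (N.integral (f ^ 2) - 2 * a * N.integral f) ≤ N.dirichletForm f := by
  have hB : N.volume {x ∈ N.carrier | a < f x} ≤ B :=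
    le_of_mul_le_mul_left ((mul_volume_superlevel_le_integral hf a).trans haB) ha
  calc _ ≤ Φ ^ 2 * N.integral ((fun x => max (f x - a) 0) ^ 2) :=
        mul_le_mul_of_nonneg_left
          (sub_le_iff_le_add.2 (integral_sq_le_integral_max_sub_sq_add hf ha.le)) (sq_nonneg Φ)
    _ ≤ N.dirichletForm fun x => max (f x - a) 0 :=
        hΦ.cheeger_inequality hΦ0 (Finset.filter_subset _ _) hB fun x hxN hx =>
          max_eq_right (sub_nonpos.2 (not_lt.1 fun hlt => hx (Finset.mem_filter.2 ⟨hxN, hlt⟩)))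
    _ ≤ N.dirichletForm f := dirichletForm_max_sub_le f a

theorem degree_mul_average {x : V} (hx : N.degree x ≠ 0) (f : V → ℝ) :
    N.degree x * N.average f x = ∑ y ∈ N.carrier, N.weight x y * f y :=
  mul_div_cancel₀ _ hx

theorem sum_weight_mul_sub_sq {x : V} (hx : N.degree x ≠ 0) (f : V → ℝ) (c : ℝ) :
    ∑ y ∈ N.carrier, N.weight x y * (c - f y) ^ 2 =
      ∑ y ∈ N.carrier, N.weight x y * (N.average f x - f y) ^ 2 +
        N.degree x * (c - N.average f x) ^ 2 := by
  have hexpand (b : ℝ) : ∑ y ∈ N.carrier, N.weight x y * (b - f y) ^ 2 =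
      N.degree x * b ^ 2 - 2 * b * (N.degree x * N.average f x) +
        ∑ y ∈ N.carrier, N.weight x y * f y ^ 2 := by
    rw [degree_mul_average hx, degree, Finset.sum_mul, Finset.mul_sum, ← Finset.sum_sub_distrib,
      ← Finset.sum_add_distrib]
    exact Finset.sum_congr rfl fun y _ => by ring
  rw [hexpand, hexpand]
  ring

/-- Laziness bounds `(f x - average f x) ^ 2` by the variance, to which the term `y = x`
contributes. -/
theorem degree_mul_average_sq_le {x : V} (hxN : x ∈ N.carrier) (hx : 0 < N.degree x) {γ : ℝ}
    (hlazy : γ * N.degree x ≤ N.weight x x) (f : V → ℝ) :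
    N.degree x * N.average f x ^ 2 ≤ ∑ y ∈ N.carrier, N.weight x y * f y ^ 2 -
      γ / 2 * ∑ y ∈ N.carrier, N.weight x y * (f x - f y) ^ 2 := by
  set variance := ∑ y ∈ N.carrier, N.weight x y * (N.average f x - f y) ^ 2 with hvariance
  have hdiag_le (a : V → ℝ) (ha : ∀ y, 0 ≤ a y) :
      N.weight x x * a x ≤ ∑ y ∈ N.carrier, N.weight x y * a y :=
    Finset.single_le_sum (f := fun y => N.weight x y * a y)
      (fun y _ => mul_nonneg (N.nonneg x y) (ha y)) hxN
  have hγ : γ ≤ 1 := by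
    have hle : N.weight x x ≤ N.degree x := by
      simpa [degree] using hdiag_le 1 fun _ => zero_le_one
    exact le_of_mul_le_mul_right (by linarith) hx
  have hvar : 0 ≤ variance :=
    Finset.sum_nonneg fun y _ => mul_nonneg (N.nonneg x y) (sq_nonneg _)
  have hdiag : γ * (N.degree x * (f x - N.average f x) ^ 2) ≤ variance := by
    have hself := hdiag_le _ fun y => sq_nonneg (N.average f x - f y)
    linarith [mul_le_mul_of_nonneg_right hlazy (sq_nonneg (N.average f x - f x))]
  have hzero := sum_weight_mul_sub_sq hx.ne' f 0
  simp only [zero_sub, neg_sq] at hzero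
  rw [hzero, sum_weight_mul_sub_sq hx.ne' f (f x), ← hvariance]
  nlinarith

theorem integral_average_sq_le {γ : ℝ} (hpos : ∀ x ∈ N.carrier, 0 < N.degree x)
    (hlazy : ∀ x ∈ N.carrier, γ * N.degree x ≤ N.weight x x) (f : V → ℝ) :
    N.integral (N.average f ^ 2) ≤ N.integral (f ^ 2) - γ / 2 * N.dirichletForm f := by
  rw [← sum_sum_weight_mul_right (f ^ 2), dirichletForm, Finset.mul_sum, ← Finset.sum_sub_distrib]
  exact Finset.sum_le_sum fun x hx => degree_mul_average_sq_le hx (hpos x hx) (hlazy x hx) f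

end FiniteNetwork

namespace MultiGraph

variable {V : Type*} (G : MultiGraph V)

theorem degree_eq_sum (x : V) (W : Finset V) (h : ∀ y, G.mult x y ≠ 0 → y ∈ W) :
    G.degree x = ∑ y ∈ W, G.mult x y :=
  finsum_eq_sum_of_support_subset _ fun y hy => h y hy

variable {G} in
theorem degree_le_degree {H : MultiGraph V} {x : V} (hfin : {y | H.mult x y ≠ 0}.Finite)
    (h : ∀ y, G.mult x y ≤ H.mult x y) : G.degree x ≤ H.degree x :=
  finsum_le_finsum' (hfin.subset fun y hy => ((Nat.pos_of_ne_zero hy).trans_le (h y)).ne') hfin h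

variable {G} in
theorem mem_verts_of_mult_ne_zero {x y : V} (hx : x ∈ G.verts) (h : G.mult x y ≠ 0) :
    y ∈ G.verts := by
  by_cases hxy : x = y
  · exact hxy ▸ hx
  · exact ⟨x, hxy, by rwa [G.symm]⟩

variable {G} in
theorem mult_ne_zero_of_step_ne_zero {x y : V} (h : G.step x y ≠ 0) : G.mult x y ≠ 0 :=
  fun h0 => h (by simp [step, h0])

theorem step_nonneg (x y : V) : 0 ≤ G.step x y :=
  div_nonneg (Nat.cast_nonneg _) (Nat.cast_nonneg _)

theorem volume_eq_sum {A : Set V} (hA : A.Finite) :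
    G.volume A = ∑ x ∈ hA.toFinset, (G.degree x : ℝ) :=
  finsum_mem_eq_finite_toFinset_sum _ hA

theorem volume_coe_eq_sum (A : Finset V) : G.volume (A : Set V) = ∑ x ∈ A, (G.degree x : ℝ) :=
  finsum_mem_coe_finset _ _

theorem volume_nonneg (A : Set V) : 0 ≤ G.volume A :=
  finsum_nonneg fun _ => finsum_nonneg fun _ => Nat.cast_nonneg _

theorem volume_mono {A B : Set V} (hB : B.Finite) (h : A ⊆ B) : G.volume A ≤ G.volume B := by
  rw [G.volume_eq_sum hB, G.volume_eq_sum (hB.subset h)]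
  exact Finset.sum_le_sum_of_subset_of_nonneg (by simpa using h) fun _ _ _ => Nat.cast_nonneg _

theorem edgeCount_coe_eq_sum (A B : Finset V) :
    G.edgeCount (A : Set V) (B : Set V) = ∑ x ∈ A, ∑ y ∈ B, (G.mult x y : ℝ) := by
  rw [edgeCount, finsum_mem_coe_finset]
  exact Finset.sum_congr rfl fun x _ => finsum_mem_coe_finset _ _

theorem edgeCount_nonneg (A B : Set V) : 0 ≤ G.edgeCount A B :=
  finsum_nonneg fun _ => finsum_nonneg fun _ => finsum_nonneg fun _ => finsum_nonneg fun _ =>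
    Nat.cast_nonneg _

theorem cheeger_nonneg : 0 ≤ G.cheeger :=
  Real.sInf_nonneg fun _ ⟨_, _, _, _, h⟩ =>
    h ▸ div_nonneg (G.edgeCount_nonneg _ _) (G.volume_nonneg _)

theorem cheeger_le {A : Set V} (hA : A ⊆ G.verts) (hne : A.Nonempty)
    (hv : G.volume A ≤ G.totalVolume / 2) :
    G.cheeger ≤ G.edgeCount A (G.verts \ A) / G.volume A := by
  refine csInf_le ⟨0, ?_⟩ ⟨A, hA, hne, hv, rfl⟩
  rintro _ ⟨_, _, _, _, rfl⟩
  exact div_nonneg (G.edgeCount_nonneg _ _) (G.volume_nonneg _)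

end MultiGraph

namespace GrowingGraph

variable {V : Type*} (𝒢 : GrowingGraph V)

theorem mult_mono {s t : ℕ} (h : s ≤ t) (x y : V) :
    (𝒢.graph s).mult x y ≤ (𝒢.graph t).mult x y :=
  monotone_nat_of_le_succ (f := fun t => (𝒢.graph t).mult x y) (fun t => 𝒢.mono t x y) h

theorem verts_mono {s t : ℕ} (h : s ≤ t) : 𝒢.verts s ⊆ 𝒢.verts t := fun x ⟨y, hy, h0⟩ =>
  ⟨y, hy, ((Nat.pos_of_ne_zero h0).trans_le (𝒢.mult_mono h x y)).ne'⟩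

/-- `V_t` as a `Finset`. -/
noncomputable def vertFinset (t : ℕ) : Finset V := (𝒢.finite_verts t).toFinset

@[simp]
theorem mem_vertFinset {t : ℕ} {x : V} : x ∈ 𝒢.vertFinset t ↔ x ∈ 𝒢.verts t :=
  Set.Finite.mem_toFinset _

@[simp]
theorem coe_vertFinset (t : ℕ) : (𝒢.vertFinset t : Set V) = 𝒢.verts t :=
  Set.Finite.coe_toFinset _

theorem vertFinset_mono {s t : ℕ} (h : s ≤ t) : 𝒢.vertFinset s ⊆ 𝒢.vertFinset t := fun _ hx =>
  𝒢.mem_vertFinset.2 (𝒢.verts_mono h (𝒢.mem_vertFinset.1 hx))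

theorem finite_mult_ne_zero (t : ℕ) (x : V) : {y | (𝒢.graph t).mult x y ≠ 0}.Finite :=
  (𝒢.locallyFinite x).subset fun y hy =>
    ((Nat.pos_of_ne_zero hy).trans_le (𝒢.le_limit t x y)).ne'

theorem degree_mono {s t : ℕ} (h : s ≤ t) (x : V) :
    (𝒢.graph s).degree x ≤ (𝒢.graph t).degree x :=
  MultiGraph.degree_le_degree (𝒢.finite_mult_ne_zero t x) (𝒢.mult_mono h x)

theorem degree_le_limit (t : ℕ) (x : V) : (𝒢.graph t).degree x ≤ 𝒢.limit.degree x :=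
  MultiGraph.degree_le_degree (𝒢.locallyFinite x) (𝒢.le_limit t x)

variable {𝒢} in
theorem degree_eq_sum_vertFinset {s t : ℕ} (hst : s ≤ t) {x : V} (hx : x ∈ 𝒢.verts s) :
    (𝒢.graph s).degree x = ∑ y ∈ 𝒢.vertFinset t, (𝒢.graph s).mult x y :=
  (𝒢.graph s).degree_eq_sum x _ fun _ hy => 𝒢.mem_vertFinset.2
    (𝒢.verts_mono hst (MultiGraph.mem_verts_of_mult_ne_zero hx hy))

variable {𝒢} in
theorem degree_pos {t : ℕ} {x : V} (hx : x ∈ 𝒢.verts t) : 0 < (𝒢.graph t).degree x := by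
  rw [degree_eq_sum_vertFinset le_rfl hx]
  obtain ⟨y, -, h0⟩ := id hx
  exact Finset.sum_pos' (fun _ _ => Nat.zero_le _) ⟨y, 𝒢.mem_vertFinset.2
    (MultiGraph.mem_verts_of_mult_ne_zero hx h0), Nat.pos_of_ne_zero h0⟩

theorem vol_eq_sum (t : ℕ) : 𝒢.vol t = ∑ x ∈ 𝒢.vertFinset t, ((𝒢.graph t).degree x : ℝ) :=
  (𝒢.graph t).volume_eq_sum (𝒢.finite_verts t)

theorem vol_mono : Monotone 𝒢.vol := fun s t h => by
  rw [vol_eq_sum, vol_eq_sum]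
  calc _ ≤ ∑ x ∈ 𝒢.vertFinset s, ((𝒢.graph t).degree x : ℝ) :=
        Finset.sum_le_sum fun x _ => Nat.cast_le.2 (𝒢.degree_mono h x)
    _ ≤ _ := Finset.sum_le_sum_of_subset_of_nonneg (𝒢.vertFinset_mono h)
        fun _ _ _ => Nat.cast_nonneg _

theorem card_le_vol (t : ℕ) : ((𝒢.vertFinset t).card : ℝ) ≤ 𝒢.vol t := by
  rw [vol_eq_sum, Finset.card_eq_sum_ones, Nat.cast_sum]
  exact Finset.sum_le_sum fun x hx => Nat.cast_le.2 (degree_pos (𝒢.mem_vertFinset.1 hx))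

variable {𝒢} in
theorem vol_pos {x : V} (hx : x ∈ 𝒢.verts 0) (t : ℕ) : 0 < 𝒢.vol t :=
  (Nat.cast_pos.2 (Finset.card_pos.2
    ⟨x, 𝒢.mem_vertFinset.2 (𝒢.verts_mono (Nat.zero_le t) hx)⟩)).trans_le (𝒢.card_le_vol t)

theorem exists_mem_verts [Nontrivial V] (x : V) : ∃ t, x ∈ 𝒢.verts t := by
  obtain ⟨y, hy⟩ := 𝒢.limit_connected.preconnected.exists_adj_of_nontrivial x
  obtain ⟨t, ht⟩ := 𝒢.exhausts x y
  exact ⟨t, y, hy.1.symm, by rw [ht]; exact hy.2⟩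

theorem limit_degree_pos [Nontrivial V] (x : V) : 0 < 𝒢.limit.degree x := by
  obtain ⟨t, ht⟩ := 𝒢.exists_mem_verts x
  exact (degree_pos ht).trans_le (𝒢.degree_le_limit t x)

theorem eventually_subset_vertFinset [Nontrivial V] (S : Finset V) :
    ∀ᶠ t in Filter.atTop, S ⊆ 𝒢.vertFinset t := by
  refine (Filter.eventually_all_finset S).2 fun x _ => ?_
  obtain ⟨t, ht⟩ := 𝒢.exists_mem_verts x
  filter_upwards [Filter.eventually_ge_atTop t] with s hs
  exact 𝒢.mem_vertFinset.2 (𝒢.verts_mono hs ht)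

theorem tendsto_vol [Infinite V] : Filter.Tendsto 𝒢.vol Filter.atTop Filter.atTop := by
  refine Filter.tendsto_atTop.2 fun b => ?_
  obtain ⟨S, hS⟩ := Infinite.exists_subset_card_eq V ⌈b⌉₊
  filter_upwards [𝒢.eventually_subset_vertFinset S] with t hSt
  calc b ≤ ⌈b⌉₊ := Nat.le_ceil b
    _ = S.card := by rw [hS]
    _ ≤ (𝒢.vertFinset t).card := Nat.cast_le.2 (Finset.card_le_card hSt)
    _ ≤ 𝒢.vol t := 𝒢.card_le_vol t

theorem VolDoubling.mono {𝒢 : GrowingGraph V} {x₀ : V} (h₀ : x₀ ∈ 𝒢.verts 0) {D D' : ℝ}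
    (h : 𝒢.VolDoubling D) (hD : D ≤ D') : 𝒢.VolDoubling D' := fun t ht =>
  (h t ht).trans (mul_le_mul_of_nonneg_right hD (vol_pos h₀ t).le)

theorem VolDoubling.nonneg {𝒢 : GrowingGraph V} {x₀ : V} (h₀ : x₀ ∈ 𝒢.verts 0) {D : ℝ}
    (h : 𝒢.VolDoubling D) : 0 ≤ D :=
  (pos_of_mul_pos_left ((vol_pos h₀ _).trans_le (h 1 le_rfl)) (vol_pos h₀ 1).le).le

theorem VolDoubling.vol_le_pow_mul_vol_div {𝒢 : GrowingGraph V} {x₀ : V} (h₀ : x₀ ∈ 𝒢.verts 0)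
    {D : ℝ} (h : 𝒢.VolDoubling D) (j : ℕ) {t : ℕ} (ht : 1 ≤ t / 2 ^ j) :
    𝒢.vol t ≤ (D ^ 2) ^ j * 𝒢.vol (t / 2 ^ j) := by
  have hD := h.nonneg h₀
  -- `t / 2` is rounded down, so two doublings are needed to get back above `t`.
  have half {u : ℕ} (hu : 1 ≤ u / 2) : 𝒢.vol u ≤ D ^ 2 * 𝒢.vol (u / 2) :=
    calc 𝒢.vol u ≤ 𝒢.vol (2 * (2 * (u / 2))) := 𝒢.vol_mono (by omega)
      _ ≤ D * 𝒢.vol (2 * (u / 2)) := h _ (by omega)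
      _ ≤ D * (D * 𝒢.vol (u / 2)) := mul_le_mul_of_nonneg_left (h _ hu) hD
      _ = _ := by ring
  induction j with
  | zero => simp
  | succ j ih =>
    rw [pow_succ 2 j, ← Nat.div_div_eq_div_mul] at ht ⊢
    calc 𝒢.vol t ≤ (D ^ 2) ^ j * 𝒢.vol (t / 2 ^ j) := ih (by omega)
      _ ≤ (D ^ 2) ^ j * (D ^ 2 * 𝒢.vol (t / 2 ^ j / 2)) := by gcongr; exact half ht
      _ = _ := by ring

section Walk

variable {𝒢} {x₀ : V} {γ : ℝ}

theorem transProb_nonneg (t : ℕ) (y : V) : 0 ≤ 𝒢.transProb x₀ t y := by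
  induction t generalizing y with
  | zero => simp only [transProb]; split_ifs <;> norm_num
  | succ t ih => exact finsum_nonneg fun z => mul_nonneg (ih z) (MultiGraph.step_nonneg _ _ _)

theorem exists_mul_step_ne_zero {t : ℕ} {y : V} (h : 𝒢.transProb x₀ (t + 1) y ≠ 0) :
    ∃ z, 𝒢.transProb x₀ t z ≠ 0 ∧ (𝒢.graph t).mult z y ≠ 0 := by
  obtain ⟨z, hz⟩ : ∃ z, 𝒢.transProb x₀ t z * (𝒢.graph t).step z y ≠ 0 := by
    by_contra! hzero
    exact h ((finsum_congr hzero).trans finsum_zero)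
  exact ⟨z, left_ne_zero_of_mul hz,
    MultiGraph.mult_ne_zero_of_step_ne_zero (right_ne_zero_of_mul hz)⟩

theorem mem_verts_of_transProb_ne_zero (h₀ : x₀ ∈ 𝒢.verts 0) {t : ℕ} {y : V}
    (h : 𝒢.transProb x₀ t y ≠ 0) : y ∈ 𝒢.verts t := by
  induction t generalizing y with
  | zero =>
    obtain rfl : y = x₀ := by_contra fun hy => h (if_neg hy)
    exact h₀
  | succ t ih =>
    obtain ⟨z, hz, hzy⟩ := exists_mul_step_ne_zero h
    exact 𝒢.verts_mono (Nat.le_succ t) (MultiGraph.mem_verts_of_mult_ne_zero (ih hz) hzy)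

theorem mem_verts_of_transProb_succ_ne_zero (h₀ : x₀ ∈ 𝒢.verts 0) {t : ℕ} {y : V}
    (h : 𝒢.transProb x₀ (t + 1) y ≠ 0) : y ∈ 𝒢.verts t := by
  obtain ⟨z, hz, hzy⟩ := exists_mul_step_ne_zero h
  exact MultiGraph.mem_verts_of_mult_ne_zero (mem_verts_of_transProb_ne_zero h₀ hz) hzy

theorem transProb_succ (h₀ : x₀ ∈ 𝒢.verts 0) {t : ℕ} {W : Finset V} (hW : 𝒢.vertFinset t ⊆ W)
    (y : V) :
    𝒢.transProb x₀ (t + 1) y = ∑ z ∈ W, 𝒢.transProb x₀ t z * (𝒢.graph t).step z y :=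
  finsum_eq_sum_of_support_subset _ fun _ hz =>
    hW (𝒢.mem_vertFinset.2 (mem_verts_of_transProb_ne_zero h₀ (left_ne_zero_of_mul hz)))

theorem sum_transProb_mul_step_le (h₀ : x₀ ∈ 𝒢.verts 0) (t : ℕ) (S : Finset V) (y : V) :
    ∑ z ∈ S, 𝒢.transProb x₀ t z * (𝒢.graph t).step z y ≤ 𝒢.transProb x₀ (t + 1) y := by
  classical
  rw [transProb_succ h₀ (W := S ∪ 𝒢.vertFinset t) Finset.subset_union_right]
  exact Finset.sum_le_sum_of_subset_of_nonneg Finset.subset_union_left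
    fun z _ _ => mul_nonneg (transProb_nonneg _ _) (MultiGraph.step_nonneg _ _ _)

theorem mul_transProb_le_succ (h₀ : x₀ ∈ 𝒢.verts 0) (hlazy : 𝒢.Lazy γ) (t : ℕ) (y : V) :
    γ * 𝒢.transProb x₀ t y ≤ 𝒢.transProb x₀ (t + 1) y := by
  by_cases hy : 𝒢.transProb x₀ t y = 0
  · rw [hy, mul_zero]
    exact transProb_nonneg _ _
  · refine le_trans ?_ (sum_transProb_mul_step_le h₀ t {y} y)
    rw [Finset.sum_singleton, mul_comm]
    exact mul_le_mul_of_nonneg_left (hlazy t y (mem_verts_of_transProb_ne_zero h₀ hy))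
      (transProb_nonneg _ _)

theorem transProb_pos_of_le (h₀ : x₀ ∈ 𝒢.verts 0) (hγ : 0 < γ) (hlazy : 𝒢.Lazy γ) {s t : ℕ}
    (hst : s ≤ t) {y : V} (h : 0 < 𝒢.transProb x₀ s y) : 0 < 𝒢.transProb x₀ t y := by
  induction t, hst using Nat.le_induction with
  | base => exact h
  | succ t _ ih => exact (mul_pos hγ ih).trans_le (mul_transProb_le_succ h₀ hlazy t y)

theorem sum_step_eq_one {s t : ℕ} (hst : s ≤ t) {x : V} (hx : x ∈ 𝒢.verts s) :
    ∑ y ∈ 𝒢.vertFinset t, (𝒢.graph s).step x y = 1 := by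
  simp only [MultiGraph.step]
  rw [← Finset.sum_div, ← Nat.cast_sum, ← degree_eq_sum_vertFinset hst hx]
  exact div_self (Nat.cast_ne_zero.2 (degree_pos hx).ne')

theorem Lazy.le_one (h₀ : x₀ ∈ 𝒢.verts 0) (hlazy : 𝒢.Lazy γ) : γ ≤ 1 :=
  (hlazy 0 x₀ h₀).trans ((Finset.single_le_sum (fun y _ => MultiGraph.step_nonneg _ _ y)
    (𝒢.mem_vertFinset.2 h₀)).trans_eq (sum_step_eq_one le_rfl h₀))

theorem mul_transProb_floor_le_ceil (h₀ : x₀ ∈ 𝒢.verts 0) (hlazy : 𝒢.Lazy γ) (s : ℝ) (y : V) :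
    γ * 𝒢.transProb x₀ ⌊s⌋₊ y ≤ 𝒢.transProb x₀ ⌈s⌉₊ y := by
  rcases (Nat.floor_le_ceil s).eq_or_lt with heq | hlt
  · rw [heq]
    exact mul_le_of_le_one_left (transProb_nonneg _ _) (hlazy.le_one h₀)
  · rw [(Nat.ceil_le_floor_add_one s).antisymm hlt]
    exact mul_transProb_le_succ h₀ hlazy _ _

theorem sum_transProb (h₀ : x₀ ∈ 𝒢.verts 0) (t : ℕ) :
    ∑ y ∈ 𝒢.vertFinset t, 𝒢.transProb x₀ t y = 1 := by
  induction t with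
  | zero =>
    simp only [transProb]
    rw [Finset.sum_eq_single_of_mem x₀ (𝒢.mem_vertFinset.2 h₀) fun y _ hy => if_neg hy, if_pos rfl]
  | succ t ih =>
    rw [Finset.sum_congr rfl fun y _ => transProb_succ h₀ subset_rfl y, Finset.sum_comm, ← ih]
    refine Finset.sum_congr rfl fun z hz => ?_
    rw [← Finset.mul_sum, sum_step_eq_one (Nat.le_succ t) (𝒢.mem_vertFinset.1 hz), mul_one]

end Walk

section Energy

/-- `graph t` with one unit of conductance per edge. -/
noncomputable def network (t : ℕ) : FiniteNetwork V where
  carrier := 𝒢.vertFinset t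
  weight x y := (𝒢.graph t).mult x y
  symm x y := by rw [(𝒢.graph t).symm]
  nonneg _ _ := Nat.cast_nonneg _

/-- The density of the walk at time `t` with respect to the degrees of `graph t`. -/
noncomputable def density (x₀ : V) (t : ℕ) (x : V) : ℝ :=
  𝒢.transProb x₀ t x / (𝒢.graph t).degree x

/-- The squared `L²` norm of the density of the walk at time `t`. -/
noncomputable def energy (x₀ : V) (t : ℕ) : ℝ := (𝒢.network t).integral (𝒢.density x₀ t ^ 2)

variable {𝒢} {x₀ : V} {γ : ℝ}

theorem network_degree {t : ℕ} {x : V} (hx : x ∈ 𝒢.verts t) :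
    (𝒢.network t).degree x = (𝒢.graph t).degree x := by
  rw [degree_eq_sum_vertFinset le_rfl hx, Nat.cast_sum]
  rfl

theorem network_degree_pos {t : ℕ} {x : V} (hx : x ∈ 𝒢.verts t) :
    0 < (𝒢.network t).degree x := by
  rw [network_degree hx]
  exact Nat.cast_pos.2 (degree_pos hx)

theorem network_integral (t : ℕ) (f : V → ℝ) :
    (𝒢.network t).integral f = ∑ x ∈ 𝒢.vertFinset t, (𝒢.graph t).degree x * f x :=
  Finset.sum_congr rfl fun _ hx => by rw [network_degree (𝒢.mem_vertFinset.1 hx)]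

theorem network_isIsoperimetric [DecidableEq V] (t : ℕ) :
    (𝒢.network t).IsIsoperimetric (𝒢.graph t).cheeger (𝒢.vol t / 2) := by
  intro S hS hv
  have hSverts : (S : Set V) ⊆ (𝒢.graph t).verts := fun x hx => 𝒢.mem_vertFinset.1 (hS hx)
  have hvol : (𝒢.network t).volume S = (𝒢.graph t).volume S := by
    rw [MultiGraph.volume_coe_eq_sum]
    exact Finset.sum_congr rfl fun x hx => network_degree (hSverts hx)
  rcases S.eq_empty_or_nonempty with rfl | hne
  · simp [FiniteNetwork.volume, FiniteNetwork.cut]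
  have hpos : 0 < (𝒢.network t).volume S :=
    Finset.sum_pos (fun x hx => network_degree_pos (hSverts hx)) hne
  have hcut : (𝒢.network t).cut S =
      (𝒢.graph t).edgeCount S ((𝒢.graph t).verts \ (S : Set V)) := by
    rw [← verts, ← coe_vertFinset, ← Finset.coe_sdiff, MultiGraph.edgeCount_coe_eq_sum]
    rfl
  rw [← le_div_iff₀ hpos, hcut, hvol]
  exact (𝒢.graph t).cheeger_le hSverts (by simpa using hne) (hvol ▸ hv)

theorem density_nonneg (t : ℕ) (x : V) : 0 ≤ 𝒢.density x₀ t x :=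
  div_nonneg (transProb_nonneg t x) (Nat.cast_nonneg _)

theorem degree_mul_density {t : ℕ} {x : V} (hx : x ∈ 𝒢.verts t) :
    (𝒢.graph t).degree x * 𝒢.density x₀ t x = 𝒢.transProb x₀ t x :=
  mul_div_cancel₀ _ (Nat.cast_ne_zero.2 (degree_pos hx).ne')

theorem integral_density (h₀ : x₀ ∈ 𝒢.verts 0) (t : ℕ) :
    (𝒢.network t).integral (𝒢.density x₀ t) = 1 := by
  rw [network_integral, ← sum_transProb h₀ t]
  exact Finset.sum_congr rfl fun x hx => degree_mul_density (𝒢.mem_vertFinset.1 hx)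

theorem sq_sum_transProb_le (t : ℕ) {S : Finset V} (hS : S ⊆ 𝒢.vertFinset t) :
    (∑ x ∈ S, 𝒢.transProb x₀ t x) ^ 2 ≤
      (∑ x ∈ S, ((𝒢.graph t).degree x : ℝ)) * 𝒢.energy x₀ t := by
  rw [energy, network_integral]
  refine (Finset.sum_sq_le_sum_mul_sum_of_sq_le_mul S (fun _ _ => Nat.cast_nonneg _)
    (g := fun x => (𝒢.graph t).degree x * (𝒢.density x₀ t ^ 2) x)
    (fun x _ => mul_nonneg (Nat.cast_nonneg _) (sq_nonneg _)) fun x hx => le_of_eq ?_).trans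
    (mul_le_mul_of_nonneg_left ?_ (Finset.sum_nonneg fun _ _ => Nat.cast_nonneg _))
  · rw [← degree_mul_density (𝒢.mem_vertFinset.1 (hS hx)), Pi.pow_apply]
    ring
  · exact Finset.sum_le_sum_of_subset_of_nonneg hS
      fun x _ _ => mul_nonneg (Nat.cast_nonneg _) (sq_nonneg _)

theorem energy_zero_le (h₀ : x₀ ∈ 𝒢.verts 0) : 𝒢.energy x₀ 0 ≤ 1 := by
  rw [energy, network_integral, ← sum_transProb h₀ 0]
  refine Finset.sum_le_sum fun x hx => ?_
  have hx := 𝒢.mem_vertFinset.1 hx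
  have hle : 𝒢.density x₀ 0 x ≤ 1 := by
    refine (div_le_self (transProb_nonneg 0 x) (Nat.one_le_cast.2 (degree_pos hx))).trans ?_
    simp only [transProb]
    split_ifs <;> norm_num
  rw [Pi.pow_apply, sq, ← mul_assoc, degree_mul_density hx]
  exact mul_le_of_le_one_right (transProb_nonneg 0 x) hle

theorem transProb_succ_eq_degree_mul_average (h₀ : x₀ ∈ 𝒢.verts 0) {t : ℕ} {y : V}
    (hy : y ∈ 𝒢.verts t) : 𝒢.transProb x₀ (t + 1) y =
      (𝒢.network t).degree y * (𝒢.network t).average (𝒢.density x₀ t) y := by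
  rw [FiniteNetwork.degree_mul_average (network_degree_pos hy).ne', transProb_succ h₀ subset_rfl]
  refine Finset.sum_congr rfl fun z _ => ?_
  rw [MultiGraph.step, density, (𝒢.graph t).symm z y, mul_div_left_comm]
  rfl

/-- Adding edges only increases the degrees, hence decreases the energy of a given distribution. -/
theorem energy_succ_le_integral_average_sq (h₀ : x₀ ∈ 𝒢.verts 0) (t : ℕ) :
    𝒢.energy x₀ (t + 1) ≤
      (𝒢.network t).integral ((𝒢.network t).average (𝒢.density x₀ t) ^ 2) := by
  have hzero (x : V) (hx : x ∉ 𝒢.vertFinset t) : 𝒢.transProb x₀ (t + 1) x = 0 :=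
    by_contra fun h => hx (𝒢.mem_vertFinset.2 (mem_verts_of_transProb_succ_ne_zero h₀ h))
  rw [energy, network_integral, ← Finset.sum_subset (𝒢.vertFinset_mono (Nat.le_succ t))
    fun x _ hx => by simp [density, hzero x hx]]
  refine Finset.sum_le_sum fun x hx => ?_
  have hxt := 𝒢.mem_vertFinset.1 hx
  have hpos := network_degree_pos hxt
  have hdeg : (𝒢.network t).degree x ≤ (𝒢.graph (t + 1)).degree x := by
    rw [network_degree hxt]
    exact Nat.cast_le.2 (𝒢.degree_mono (Nat.le_succ t) x)
  calc _ = ((𝒢.network t).degree x * (𝒢.network t).average (𝒢.density x₀ t) x) ^ 2 /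
          (𝒢.graph (t + 1)).degree x := by
        rw [← transProb_succ_eq_degree_mul_average h₀ hxt, Pi.pow_apply, density]
        field_simp [(hpos.trans_le hdeg).ne']
    _ ≤ ((𝒢.network t).degree x * (𝒢.network t).average (𝒢.density x₀ t) x) ^ 2 /
          (𝒢.network t).degree x := div_le_div_of_nonneg_left (sq_nonneg _) hpos hdeg
    _ = _ := by
        rw [Pi.pow_apply]
        field_simp

theorem energy_succ_le (h₀ : x₀ ∈ 𝒢.verts 0) (hlazy : 𝒢.Lazy γ) (t : ℕ) :
    𝒢.energy x₀ (t + 1) ≤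
      𝒢.energy x₀ t - γ / 2 * (𝒢.network t).dirichletForm (𝒢.density x₀ t) := by
  refine (energy_succ_le_integral_average_sq h₀ t).trans (FiniteNetwork.integral_average_sq_le
    (fun x hx => network_degree_pos (𝒢.mem_vertFinset.1 hx)) (fun x hx => ?_) _)
  have hxt := 𝒢.mem_vertFinset.1 hx
  rw [← le_div_iff₀ (network_degree_pos hxt), network_degree hxt]
  exact hlazy t x hxt

theorem cheeger_sq_mul_energy_sub_le (h₀ : x₀ ∈ 𝒢.verts 0) (t : ℕ) :
    (𝒢.graph t).cheeger ^ 2 * (𝒢.energy x₀ t - 4 / 𝒢.vol t) ≤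
      (𝒢.network t).dirichletForm (𝒢.density x₀ t) := by
  classical
  have hv := vol_pos h₀ t
  have hone := integral_density h₀ t
  have hnash := (network_isIsoperimetric (𝒢 := 𝒢) t).nash_inequality
    (MultiGraph.cheeger_nonneg _) (density_nonneg (x₀ := x₀) t) (a := 2 / 𝒢.vol t) (by positivity)
    (by rw [hone, div_mul_div_cancel₀ hv.ne', div_self two_ne_zero])
  rwa [hone, mul_one, mul_div_assoc', show (2 * 2 : ℝ) = 4 by norm_num] at hnash

theorem energy_antitone (h₀ : x₀ ∈ 𝒢.verts 0) (hγ : 0 ≤ γ) (hlazy : 𝒢.Lazy γ) :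
    Antitone (𝒢.energy x₀) :=
  antitone_nat_of_succ_le fun t => (energy_succ_le h₀ hlazy t).trans
    (sub_le_self _ (mul_nonneg (by linarith) (FiniteNetwork.dirichletForm_nonneg _)))

theorem energy_le_exp_add (h₀ : x₀ ∈ 𝒢.verts 0) (hγ : 0 ≤ γ) (hlazy : 𝒢.Lazy γ) {s t : ℕ}
    (hst : s ≤ t) :
    𝒢.energy x₀ t ≤ Real.exp (-(γ / 2 * ∑ u ∈ Finset.Ico s t, (𝒢.graph u).cheeger ^ 2)) +
      4 / 𝒢.vol s := by
  have hs := vol_pos h₀ s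
  have hanti := energy_antitone h₀ hγ hlazy
  set K := 4 / 𝒢.vol s
  have hK0 : 0 ≤ K := by positivity
  induction t, hst using Nat.le_induction with
  | base =>
    have := (hanti (Nat.zero_le s)).trans (energy_zero_le h₀)
    simpa using this.trans (le_add_of_nonneg_right hK0)
  | succ t hst ih =>
    rcases le_total (𝒢.energy x₀ t) K with hle | hge
    · exact (hanti (Nat.le_succ t)).trans (hle.trans (le_add_of_nonneg_left (Real.exp_pos _).le))
    set q := γ / 2 * (𝒢.graph t).cheeger ^ 2 with hq
    have hvol : 4 / 𝒢.vol t ≤ K := div_le_div_of_nonneg_left (by norm_num) hs (𝒢.vol_mono hst)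
    have hcontract : 𝒢.energy x₀ (t + 1) - K ≤ (1 - q) * (𝒢.energy x₀ t - K) := by
      have hq0 : 0 ≤ q := by positivity
      have hdrop :=
        mul_le_mul_of_nonneg_left (cheeger_sq_mul_energy_sub_le h₀ t) (div_nonneg hγ zero_le_two)
      nlinarith [energy_succ_le h₀ hlazy t, mul_le_mul_of_nonneg_left hvol hq0]
    rw [Finset.sum_Ico_succ_top hst, mul_add, neg_add_rev, Real.exp_add, ← hq,
      ← sub_le_iff_le_add]
    calc _ ≤ (1 - q) * (𝒢.energy x₀ t - K) := hcontract
      _ ≤ Real.exp (-q) * (𝒢.energy x₀ t - K) :=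
        mul_le_mul_of_nonneg_right (Real.one_sub_le_exp_neg q) (sub_nonneg.2 hge)
      _ ≤ _ := mul_le_mul_of_nonneg_left (sub_le_iff_le_add.2 ih) (Real.exp_pos _).le

theorem Regular.eventually_le [Infinite V] {ζ : ℝ} (hζ : 0 < ζ) (hreg : 𝒢.Regular ζ) :
    ∀ᶠ t : ℕ in Filter.atTop, ζ / 2 * Real.log (𝒢.vol (t / 2)) ≤
      ∑ u ∈ Finset.Ico (t / 2) t, (𝒢.graph u).cheeger ^ 2 := by
  have hlt := lt_of_lt_of_le (EReal.coe_lt_coe_iff.2 (half_lt_self hζ)) hreg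
  have hhalf : Filter.Tendsto (fun t : ℕ => t / 2) Filter.atTop Filter.atTop :=
    Nat.tendsto_div_const_atTop two_ne_zero
  filter_upwards [Filter.eventually_lt_of_lt_liminf hlt,
    (𝒢.tendsto_vol.comp hhalf).eventually_gt_atTop 1] with t ht hv
  exact ((lt_div_iff₀ (Real.log_pos hv)).1 (EReal.coe_lt_coe_iff.1 ht)).le

theorem mul_log_vol_div_le_sum_cheeger_sq (h₀ : x₀ ∈ 𝒢.verts 0) {a : ℝ} (ha : 0 ≤ a) {T : ℕ}
    (hT : ∀ t ≥ T, a * Real.log (𝒢.vol (t / 2)) ≤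
      ∑ u ∈ Finset.Ico (t / 2) t, (𝒢.graph u).cheeger ^ 2)
    (j : ℕ) {t : ℕ} (ht : T ≤ t / 2 ^ j) :
    j * a * Real.log (𝒢.vol (t / 2 ^ j)) ≤
      ∑ u ∈ Finset.Ico (t / 2 ^ j) t, (𝒢.graph u).cheeger ^ 2 := by
  induction j with
  | zero => simp
  | succ j ih =>
    rw [pow_succ, ← Nat.div_div_eq_div_mul] at ht ⊢
    set w := t / 2 ^ j
    have hlog : j * a * Real.log (𝒢.vol (w / 2)) ≤ j * a * Real.log (𝒢.vol w) := by
      gcongr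
      · exact vol_pos h₀ _
      · exact 𝒢.vol_mono (Nat.div_le_self w 2)
    rw [← Finset.sum_Ico_consecutive _ (Nat.div_le_self w 2) (Nat.div_le_self t (2 ^ j))]
    push_cast
    linarith [ih (by omega), hT w (by omega)]

/-- The constant in the on-diagonal bound `energy ≤ decayConst γ ζ D / v(t)`. The exponent is the
number of dyadic time scales over which the exponential decay reaches the order `1 / v(t)`. -/
noncomputable def decayConst (γ ζ D : ℝ) : ℝ := 5 * (D ^ 2) ^ ⌈4 / (γ * ζ)⌉₊

theorem decayConst_pos (γ ζ : ℝ) {D : ℝ} (hD : 0 < D) : 0 < decayConst γ ζ D := by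
  rw [decayConst]
  positivity

theorem eventually_energy_le [Infinite V] (h₀ : x₀ ∈ 𝒢.verts 0) {ζ D : ℝ} (hγ : 0 < γ)
    (hζ : 0 < ζ) (hlazy : 𝒢.Lazy γ) (hreg : 𝒢.Regular ζ) (hdoub : 𝒢.VolDoubling D) :
    ∀ᶠ t : ℕ in Filter.atTop, 𝒢.energy x₀ t ≤ decayConst γ ζ D / 𝒢.vol t := by
  obtain ⟨T, hT⟩ := Filter.eventually_atTop.1 (hreg.eventually_le hζ)
  set k := ⌈4 / (γ * ζ)⌉₊ with hk
  have hscale : Filter.Tendsto (fun t : ℕ => t / 2 ^ k) Filter.atTop Filter.atTop :=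
    Nat.tendsto_div_const_atTop (by positivity)
  filter_upwards [hscale.eventually_ge_atTop (max T 1),
    (𝒢.tendsto_vol.comp hscale).eventually_ge_atTop 1] with t ht hv
  rw [max_le_iff] at ht
  simp only [Function.comp_apply] at hv
  set w := t / 2 ^ k
  have hw0 := vol_pos h₀ w
  have hrate : 1 ≤ γ / 2 * (k * (ζ / 2)) := by
    have := Nat.le_ceil (4 / (γ * ζ))
    rw [← hk, div_le_iff₀ (by positivity)] at this
    linarith
  have hexp : Real.exp (-(γ / 2 * ∑ u ∈ Finset.Ico w t, (𝒢.graph u).cheeger ^ 2)) ≤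
      1 / 𝒢.vol w := by
    rw [one_div, ← Real.exp_log (inv_pos.2 hw0), Real.log_inv]
    refine Real.exp_le_exp.2 (neg_le_neg ?_)
    calc Real.log (𝒢.vol w) ≤ γ / 2 * (k * (ζ / 2)) * Real.log (𝒢.vol w) :=
          le_mul_of_one_le_left (Real.log_nonneg hv) hrate
      _ = γ / 2 * (k * (ζ / 2) * Real.log (𝒢.vol w)) := mul_assoc _ _ _
      _ ≤ _ := by
        gcongr
        exact mul_log_vol_div_le_sum_cheeger_sq h₀ (by positivity) hT k ht.1
  calc 𝒢.energy x₀ t ≤ 1 / 𝒢.vol w + 4 / 𝒢.vol w :=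
        (energy_le_exp_add h₀ hγ.le hlazy (Nat.div_le_self t (2 ^ k))).trans (by gcongr)
    _ = 5 / 𝒢.vol w := by ring
    _ ≤ decayConst γ ζ D / 𝒢.vol t := by
        rw [div_le_div_iff₀ hw0 (vol_pos h₀ t), decayConst, mul_assoc]
        gcongr
        exact hdoub.vol_le_pow_mul_vol_div h₀ k ht.2

end Energy

end GrowingGraph

namespace MultiGraph

variable {V : Type*} {G : MultiGraph V}

theorem mem_ball {x y : V} {R : ℝ} : y ∈ G.ball x R ↔ (G.toSimple.dist x y : ℝ) ≤ R := Iff.rfl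

theorem ball_mono (x : V) {R S : ℝ} (h : R ≤ S) : G.ball x R ⊆ G.ball x S :=
  fun _ hy => le_trans hy h

theorem ball_floor (x : V) {R : ℝ} (hR : 0 ≤ R) : G.ball x ⌊R⌋₊ = G.ball x R := by
  ext y
  rw [mem_ball, mem_ball, Nat.cast_le, Nat.le_floor_iff hR]

theorem mem_ball_self (x : V) {R : ℝ} (hR : 0 ≤ R) : x ∈ G.ball x R := by
  simpa [mem_ball] using hR

theorem ball_subset_ball (hG : G.toSimple.Connected) {x y : V} {R S : ℝ}
    (h : G.toSimple.dist x y + R ≤ S) : G.ball y R ⊆ G.ball x S := fun z hz => by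
  have htri : (G.toSimple.dist x z : ℝ) ≤ G.toSimple.dist x y + G.toSimple.dist y z := by
    exact_mod_cast hG.dist_triangle
  rw [mem_ball] at hz ⊢
  linarith

theorem volume_ball_pos {x : V} {R : ℝ} (hfin : (G.ball x R).Finite) (hx : 0 < G.degree x)
    (hR : 0 ≤ R) : 0 < G.volume (G.ball x R) := by
  rw [G.volume_eq_sum hfin]
  exact Finset.sum_pos' (fun _ _ => Nat.cast_nonneg _)
    ⟨x, hfin.mem_toFinset.2 (mem_ball_self x hR), Nat.cast_pos.2 hx⟩

theorem dist_le_succ_of_mult_ne_zero (hG : G.toSimple.Connected) (x : V) {y z : V}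
    (h : G.mult y z ≠ 0) : G.toSimple.dist x z ≤ G.toSimple.dist x y + 1 := by
  by_cases hyz : y = z
  · exact hyz ▸ Nat.le_succ _
  · rw [← SimpleGraph.dist_eq_one_iff_adj.2 (show G.toSimple.Adj y z from ⟨hyz, h⟩)]
    exact hG.dist_triangle

theorem exists_dist_eq (hG : G.toSimple.Connected) (x y : V) {k : ℕ}
    (hk : k ≤ G.toSimple.dist x y) :
    ∃ z, G.toSimple.dist x z + k = G.toSimple.dist x y ∧ G.toSimple.dist z y = k := by
  obtain ⟨p, hp⟩ := hG.exists_walk_length_eq_dist x y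
  set L := G.toSimple.dist x y
  have hxz : G.toSimple.dist x (p.getVert (L - k)) ≤ L - k :=
    (SimpleGraph.dist_le (p.take (L - k))).trans (by simp)
  have hzy : G.toSimple.dist (p.getVert (L - k)) y ≤ k :=
    (SimpleGraph.dist_le (p.drop (L - k))).trans (by rw [SimpleGraph.Walk.drop_length]; omega)
  have htri := hG.dist_triangle (u := x) (v := p.getVert (L - k)) (w := y)
  exact ⟨p.getVert (L - k), by omega, by omega⟩

theorem VolumeDoubling.mono {D D' : ℝ} (h : G.VolumeDoubling D) (hD : D ≤ D') :
    G.VolumeDoubling D' := fun x R hR =>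
  (h x R hR).trans (mul_le_mul_of_nonneg_right hD (G.volume_nonneg _))

theorem VolumeDoubling.volume_ball_three_mul_le (hG : G.toSimple.Connected)
    (hfin : ∀ x R, (G.ball x R).Finite) {D : ℝ} (hD0 : 0 ≤ D) (hD : G.VolumeDoubling D)
    {z w : V} {h : ℝ} (hh : 0 < h) (hw : w ∈ G.ball z h) :
    G.volume (G.ball w (3 * h)) ≤ D ^ 2 * G.volume (G.ball z h) :=
  calc G.volume (G.ball w (3 * h)) ≤ G.volume (G.ball z (2 * (2 * h))) :=
        G.volume_mono (hfin _ _) (ball_subset_ball hG (by rw [mem_ball] at hw; linarith))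
    _ ≤ D * (D * G.volume (G.ball z h)) := (hD z _ (by linarith)).trans
        (mul_le_mul_of_nonneg_left (hD z h hh) hD0)
    _ = _ := by ring

/-- The annulus `{y | R < d(x, y) ≤ S}`. -/
def annulus (G : MultiGraph V) (x : V) (R S : ℝ) : Set V := G.ball x S \ G.ball x R

theorem mem_annulus {x y : V} {R S : ℝ} :
    y ∈ G.annulus x R S ↔ (G.toSimple.dist x y : ℝ) ≤ S ∧ R < G.toSimple.dist x y := by
  rw [annulus, Set.mem_sdiff, mem_ball, mem_ball, not_le]

theorem volume_annulus {x : V} {R S : ℝ} (hfin : (G.ball x S).Finite) (h : R ≤ S) :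
    G.volume (G.annulus x R S) = G.volume (G.ball x S) - G.volume (G.ball x R) := by
  rw [annulus, volume, volume, volume, eq_sub_iff_add_eq']
  exact finsum_mem_add_sdiff (ball_mono x h) hfin

/-- A ball of radius `h` inside `B(x, 3h)` and the inner annulus: go back from `x` by `2h` steps
towards `x₀`. -/
theorem exists_ball_subset_annulus (hG : G.toSimple.Connected) {x₀ x : V} {R : ℝ} {h : ℕ}
    (hR : 3 * h ≤ R) (hx : x ∈ G.annulus x₀ (R - h) R) :
    ∃ z, G.ball z h ⊆ G.annulus x₀ (R - 4 * h) (R - h) ∧ G.ball z h ⊆ G.ball x (3 * h) := by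
  rw [mem_annulus] at hx
  have hk : 2 * h ≤ G.toSimple.dist x₀ x := by
    have : (2 * h : ℝ) ≤ G.toSimple.dist x₀ x := by linarith [Nat.cast_nonneg (α := ℝ) h]
    exact_mod_cast this
  obtain ⟨z, hz, hzx⟩ := exists_dist_eq hG x₀ x hk
  have hz : (G.toSimple.dist x₀ z : ℝ) + 2 * h = G.toSimple.dist x₀ x := by exact_mod_cast hz
  refine ⟨z, fun w hw => ?_, ball_subset_ball hG ?_⟩
  · have hzw : (G.toSimple.dist z w : ℝ) ≤ h := hw
    have hout : (G.toSimple.dist x₀ w : ℝ) ≤ G.toSimple.dist x₀ z + G.toSimple.dist z w := by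
      exact_mod_cast hG.dist_triangle
    have hin : (G.toSimple.dist x₀ z : ℝ) ≤ G.toSimple.dist x₀ w + G.toSimple.dist z w := by
      rw [SimpleGraph.dist_comm (u := z)]
      exact_mod_cast hG.dist_triangle
    rw [mem_annulus]
    constructor <;> linarith
  · rw [SimpleGraph.dist_comm, hzx]
    push_cast
    linarith

open Classical in
theorem one_le_sum_degree_div_volume (hG : G.toSimple.Connected)
    (hfin : ∀ x R, (G.ball x R).Finite) (hdeg : ∀ x, 0 < G.degree x) {D : ℝ} (hD0 : 0 ≤ D)
    (hD : G.VolumeDoubling D) {x₀ x : V} {R : ℝ} {h : ℕ} (hh : 1 ≤ h) (hR : 3 * h ≤ R)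
    (hx : x ∈ G.annulus x₀ (R - h) R) {A : Finset V}
    (hA : G.annulus x₀ (R - 4 * h) (R - h) ⊆ A) :
    1 ≤ D ^ 2 * ∑ w ∈ A with x ∈ G.ball w (3 * h),
      G.degree w / G.volume (G.ball w (3 * h)) := by
  have hh0 : (0 : ℝ) < h := by exact_mod_cast hh
  have hpos (w : V) {S : ℝ} (hS : 0 ≤ S) := volume_ball_pos (hfin w S) (hdeg w) hS
  obtain ⟨z, hzA, hzx⟩ := exists_ball_subset_annulus hG hR hx
  have hsub : (hfin z h).toFinset ⊆ {w ∈ A | x ∈ G.ball w (3 * h)} := fun w hw => by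
    rw [Set.Finite.mem_toFinset] at hw
    refine Finset.mem_filter.2 ⟨hA (hzA hw), ?_⟩
    rw [mem_ball, SimpleGraph.dist_comm]
    exact hzx hw
  have hvz := hpos z hh0.le
  calc 1 = ∑ w ∈ (hfin z h).toFinset, (G.degree w : ℝ) / G.volume (G.ball z h) := by
        rw [← Finset.sum_div, ← G.volume_eq_sum, div_self hvz.ne']
    _ ≤ ∑ w ∈ (hfin z h).toFinset,
          D ^ 2 * (G.degree w / G.volume (G.ball w (3 * h))) := by
        refine Finset.sum_le_sum fun w hw => ?_
        have hle := hD.volume_ball_three_mul_le hG hfin hD0 hh0 ((hfin z h).mem_toFinset.1 hw)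
        rw [← mul_div_assoc, div_le_div_iff₀ hvz (hpos w (by positivity)), mul_comm (D ^ 2),
          mul_assoc]
        gcongr
    _ ≤ _ := by
        rw [← Finset.mul_sum]
        exact mul_le_mul_of_nonneg_left (Finset.sum_le_sum_of_subset_of_nonneg hsub
          fun w _ _ => div_nonneg (Nat.cast_nonneg _) (G.volume_nonneg _)) (sq_nonneg D)

theorem volume_annulus_le (hG : G.toSimple.Connected) (hfin : ∀ x R, (G.ball x R).Finite)
    (hdeg : ∀ x, 0 < G.degree x) {D : ℝ} (hD0 : 0 ≤ D) (hD : G.VolumeDoubling D) (x₀ : V) {R : ℝ}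
    {h : ℕ} (hh : 1 ≤ h) (hR : 3 * h ≤ R) :
    G.volume (G.annulus x₀ (R - h) R) ≤
      D ^ 2 * G.volume (G.annulus x₀ (R - 4 * h) (R - h)) := by
  classical
  have hfinA (S T : ℝ) : (G.annulus x₀ S T).Finite := (hfin x₀ T).sdiff
  rw [G.volume_eq_sum (hfinA _ _), G.volume_eq_sum (hfinA _ _)]
  set A := (hfinA (R - h) R).toFinset
  set A' := (hfinA (R - 4 * h) (R - h)).toFinset with hA'
  set v : V → ℝ := fun w => G.volume (G.ball w (3 * h))
  have hv (w : V) : 0 < v w := volume_ball_pos (hfin w _) (hdeg w) (by positivity)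
  calc ∑ x ∈ A, (G.degree x : ℝ)
      ≤ ∑ x ∈ A, (G.degree x : ℝ) *
          (D ^ 2 * ∑ w ∈ A' with x ∈ G.ball w (3 * h), G.degree w / v w) := by
        refine Finset.sum_le_sum fun x hx => le_mul_of_one_le_right (Nat.cast_nonneg _) ?_
        exact one_le_sum_degree_div_volume hG hfin hdeg hD0 hD hh hR
          ((hfinA _ _).mem_toFinset.1 hx) (by rw [hA', Set.Finite.coe_toFinset])
    _ = D ^ 2 * ∑ w ∈ A', G.degree w / v w *
          ∑ x ∈ A with x ∈ G.ball w (3 * h), (G.degree x : ℝ) := by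
        simp only [Finset.sum_filter, Finset.mul_sum]
        rw [Finset.sum_comm]
        refine Finset.sum_congr rfl fun w _ => Finset.sum_congr rfl fun x _ => ?_
        split_ifs <;> ring
    _ ≤ D ^ 2 * ∑ w ∈ A', G.degree w / v w * v w := by
        gcongr with w _
        · exact div_nonneg (Nat.cast_nonneg _) (hv w).le
        · refine (G.volume_coe_eq_sum _).symm.trans_le (G.volume_mono (hfin _ _) fun x hx => ?_)
          exact (Finset.mem_filter.1 hx).2
    _ = D ^ 2 * ∑ w ∈ A', (G.degree w : ℝ) := by
        simp only [div_mul_cancel₀ _ (hv _).ne']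

theorem volume_annulus_pow_le (hG : G.toSimple.Connected) (hfin : ∀ x R, (G.ball x R).Finite)
    (hdeg : ∀ x, 0 < G.degree x) {D : ℝ} (hD0 : 0 < D) (hD : G.VolumeDoubling D) (x₀ : V) {R : ℝ}
    {h : ℕ} (hh : 1 ≤ h) (j : ℕ) (hR : 4 ^ j * h ≤ R) :
    (1 + (D ^ 2)⁻¹) ^ j * G.volume (G.annulus x₀ (R - h) R) ≤
      G.volume (G.annulus x₀ (R - 4 ^ j * h) R) := by
  induction j with
  | zero => simp
  | succ j ih =>
    set k := 4 ^ j * h with hk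
    have hk1 : 1 ≤ k := Nat.one_le_iff_ne_zero.2 (by positivity)
    have hkcast : (4 : ℝ) ^ j * h = k := by rw [hk]; push_cast; rfl
    have hsucc : (4 : ℝ) ^ (j + 1) * h = 4 * k := by rw [← hkcast]; ring
    have hk0 : (0 : ℝ) < k := by exact_mod_cast hk1
    rw [hsucc] at hR ⊢
    rw [hkcast] at ih
    have hnext := volume_annulus_le hG hfin hdeg hD0.le hD x₀ hk1 (by linarith : 3 * (k : ℝ) ≤ R)
    rw [← inv_mul_le_iff₀ (by positivity)] at hnext
    have hunion : G.volume (G.annulus x₀ (R - 4 * k) R) =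
        G.volume (G.annulus x₀ (R - k) R) + G.volume (G.annulus x₀ (R - 4 * k) (R - k)) := by
      rw [volume_annulus (hfin _ _) (by linarith), volume_annulus (hfin _ _) (by linarith),
        volume_annulus (hfin _ _) (by linarith)]
      ring
    calc _ = (1 + (D ^ 2)⁻¹) * ((1 + (D ^ 2)⁻¹) ^ j * G.volume (G.annulus x₀ (R - h) R)) := by
          ring
      _ ≤ (1 + (D ^ 2)⁻¹) * G.volume (G.annulus x₀ (R - k) R) := by
          gcongr
          exact ih (by linarith)
      _ ≤ _ := by rw [hunion]; linarith

theorem exists_volume_ball_ge (D : ℝ) {ε : ℝ} (hε : 0 < ε) :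
    ∃ θ : ℝ, θ < 1 ∧ ∀ (V : Type*) (G : MultiGraph V), G.toSimple.Connected →
      (∀ x R, (G.ball x R).Finite) → (∀ x, 0 < G.degree x) → G.VolumeDoubling D →
      ∀ x₀ : V, ∀ᶠ R in Filter.atTop,
        (1 - ε) * G.volume (G.ball x₀ R) ≤ G.volume (G.ball x₀ (θ * R)) := by
  have hD1 : 0 < max D 1 := lt_max_of_lt_right one_pos
  obtain ⟨k, hk⟩ := pow_unbounded_of_one_lt ε⁻¹ (show 1 < 1 + (max D 1 ^ 2)⁻¹ by
    linarith [inv_pos.2 (pow_pos hD1 2)])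
  refine ⟨1 - 1 / (2 * 4 ^ k), sub_lt_self _ (by positivity), fun V G hG hfin hdeg hD x₀ => ?_⟩
  filter_upwards [Filter.eventually_ge_atTop (2 * 4 ^ k)] with R hR
  set h := ⌊R / 4 ^ k⌋₊
  have hRk : 2 ≤ R / 4 ^ k := (le_div_iff₀ (by positivity)).2 hR
  have hh : 1 ≤ h := Nat.one_le_floor_iff _ |>.2 (by linarith)
  have hhR : 4 ^ k * h ≤ R := by
    rw [← le_div_iff₀' (by positivity)]
    exact Nat.floor_le (by linarith)
  have hRh : R / (2 * 4 ^ k) ≤ h := by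
    rw [mul_comm, ← div_div]
    linarith [Nat.lt_floor_add_one (R / 4 ^ k)]
  have hgrow := volume_annulus_pow_le hG hfin hdeg hD1 (hD.mono (le_max_left _ _)) x₀ hh k hhR
  have hthin : G.volume (G.annulus x₀ (R - h) R) ≤ ε * G.volume (G.ball x₀ R) := by
    rw [← inv_mul_le_iff₀ hε]
    calc _ ≤ (1 + (max D 1 ^ 2)⁻¹) ^ k * G.volume (G.annulus x₀ (R - h) R) :=
          mul_le_mul_of_nonneg_right hk.le (G.volume_nonneg _)
      _ ≤ _ := hgrow.trans (G.volume_mono (hfin _ _) Set.sdiff_subset)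
  rw [volume_annulus (hfin _ _) (by linarith [Nat.cast_nonneg (α := ℝ) h])] at hthin
  have hinner : G.volume (G.ball x₀ (R - h)) ≤ G.volume (G.ball x₀ ((1 - 1 / (2 * 4 ^ k)) * R)) :=
    G.volume_mono (hfin _ _) (ball_mono x₀ (by rw [sub_mul, one_mul, one_div_mul_eq_div]; linarith))
  linarith

section Killed

variable {B : Set V} {k : ℕ} {x y : V}

theorem killed_nonneg (S : Set V) (k : ℕ) (x y : V) : 0 ≤ G.killed S k x y := by
  induction k generalizing y with
  | zero => simp only [killed]; split_ifs <;> norm_num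
  | succ k ih =>
    simp only [killed]
    split_ifs
    · exact le_rfl
    · exact finsum_nonneg fun z => mul_nonneg (ih z) (G.step_nonneg _ _)

theorem mem_of_killed_ne_zero (hx : x ∈ B) (h : G.killed (G.innerBoundary B) k x y ≠ 0) :
    y ∈ B \ G.innerBoundary B := by
  induction k generalizing y with
  | zero =>
    simp only [killed, ne_eq, ite_eq_right_iff, one_ne_zero, imp_false, not_not] at h
    exact ⟨h.1 ▸ hx, h.2⟩
  | succ k ih =>
    simp only [killed, ne_eq, ite_eq_left_iff, not_forall] at h
    obtain ⟨hy, h⟩ := h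
    obtain ⟨z, hz⟩ : ∃ z, G.killed (G.innerBoundary B) k x z * G.step z y ≠ 0 := by
      by_contra! hzero
      exact h (by rw [finsum_congr hzero, finsum_zero])
    obtain ⟨hzB, hzS⟩ := ih (left_ne_zero_of_mul hz)
    refine ⟨by_contra fun hyB => hzS ⟨hzB, y, hyB, ?_⟩, hy⟩
    exact mult_ne_zero_of_step_ne_zero (right_ne_zero_of_mul hz)

theorem killed_succ_le (hB : (B \ G.innerBoundary B).Finite) (hx : x ∈ B) :
    G.killed (G.innerBoundary B) (k + 1) x y ≤
      ∑ z ∈ hB.toFinset, G.killed (G.innerBoundary B) k x z * G.step z y := by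
  simp only [killed]
  split_ifs
  · exact Finset.sum_nonneg fun z _ => mul_nonneg (killed_nonneg _ _ _ _) (G.step_nonneg _ _)
  · refine (finsum_eq_sum_of_support_subset _ fun z hz => ?_).le
    rw [Set.Finite.coe_toFinset]
    exact mem_of_killed_ne_zero hx (left_ne_zero_of_mul hz)

end Killed

theorem notMem_innerBoundary_ball (hG : G.toSimple.Connected) {x₀ x : V} {R S : ℝ}
    (hx : x ∈ G.ball x₀ R) (hRS : R + 1 ≤ S) : x ∉ G.innerBoundary (G.ball x₀ S) := by
  rintro ⟨-, y, hy, hxy⟩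
  have hdist : (G.toSimple.dist x₀ y : ℝ) ≤ G.toSimple.dist x₀ x + 1 := by
    exact_mod_cast dist_le_succ_of_mult_ne_zero hG x₀ hxy
  rw [mem_ball] at hx hy
  linarith

theorem LLE.le_killed (hG : G.toSimple.Connected) {x₀ x y : V} {ψ cHK : ℝ → ℝ}
    (hLLE : G.LLE x₀ ψ cHK) {δ m : ℝ} (hδ : 0 < δ) (hδ' : δ < 1) (hδm : 1 ≤ δ * m)
    (hx : x ∈ G.ball x₀ ((1 - δ) * m)) (hy : y ∈ G.ball x₀ ((1 - δ) * m)) :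
    cHK δ / G.volume (G.ball x₀ m) ≤
      G.killed (G.innerBoundary (G.ball x₀ m)) ⌊ψ m⌋₊ x y := by
  have hm : (1 - δ) * m + 1 ≤ m := by linarith
  exact hLLE δ hδ hδ' m (by nlinarith) x ⟨hx, notMem_innerBoundary_ball hG hx hm⟩
    y ⟨hy, notMem_innerBoundary_ball hG hy hm⟩

end MultiGraph

namespace GrowingGraph

variable {V : Type*} {𝒢 : GrowingGraph V} {x₀ : V} {r : ℝ → ℝ}

namespace BallLike

theorem mono (hr : 𝒢.BallLike x₀ r) {a b : ℝ} (ha : 0 ≤ a) (hab : a ≤ b) : r a ≤ r b :=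
  hr.monotoneOn ha (ha.trans hab) hab

theorem mono_nat (hr : 𝒢.BallLike x₀ r) : Monotone fun t : ℕ => r t :=
  fun a _ hab => hr.mono a.cast_nonneg (Nat.cast_le.2 hab)

theorem eventually_vol_sub_lt (hr : 𝒢.BallLike x₀ r) (h₀ : x₀ ∈ 𝒢.verts 0) {ε : ℝ} (hε : 0 < ε) :
    ∀ᶠ t : ℕ in Filter.atTop,
      𝒢.vol t - 𝒢.limit.volume (𝒢.limit.ball x₀ (r t)) < ε * 𝒢.vol t := by
  filter_upwards [hr.tendsto.eventually_lt_const hε] with t ht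
  exact (div_lt_iff₀ (vol_pos h₀ t)).1 ht

section Infinite

variable [Infinite V]

theorem tendsto_volume_ball (hr : 𝒢.BallLike x₀ r) (h₀ : x₀ ∈ 𝒢.verts 0) :
    Filter.Tendsto (fun t : ℕ => 𝒢.limit.volume (𝒢.limit.ball x₀ (r t)))
      Filter.atTop Filter.atTop := by
  refine Filter.tendsto_atTop_mono' _ ?_ (𝒢.tendsto_vol.atTop_div_const two_pos)
  filter_upwards [hr.eventually_vol_sub_lt h₀ one_half_pos] with t ht
  linarith

theorem tendsto_radius (hr : 𝒢.BallLike x₀ r) (h₀ : x₀ ∈ 𝒢.verts 0) :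
    Filter.Tendsto (fun t : ℕ => r t) Filter.atTop Filter.atTop := by
  suffices Filter.Tendsto (fun t : ℕ => ⌊r t⌋₊) Filter.atTop Filter.atTop from
    Filter.tendsto_atTop_mono (fun t => Nat.floor_le (hr.pos t t.cast_nonneg).le)
      (tendsto_natCast_atTop_atTop.comp this)
  refine Filter.tendsto_atTop.2 fun n => ?_
  have hne : ∀ᶠ t : ℕ in Filter.atTop, ∀ k ∈ Finset.range n, ⌊r t⌋₊ ≠ k := by
    refine (Filter.eventually_all_finset _).2 fun k _ => ?_
    filter_upwards [(hr.tendsto_volume_ball h₀).eventually_gt_atTop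
      (𝒢.limit.volume (𝒢.limit.ball x₀ k))] with t ht hk
    rw [← MultiGraph.ball_floor x₀ (hr.pos t t.cast_nonneg).le, hk] at ht
    exact ht.false
  filter_upwards [hne] with t ht
  exact not_lt.1 fun hlt => ht _ (Finset.mem_range.2 hlt) rfl

theorem ball_finite (hr : 𝒢.BallLike x₀ r) (h₀ : x₀ ∈ 𝒢.verts 0) (x : V) (R : ℝ) :
    (𝒢.limit.ball x R).Finite := by
  obtain ⟨t, ht⟩ := ((hr.tendsto_radius h₀).eventually_ge_atTop
    (𝒢.limit.toSimple.dist x₀ x + R)).exists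
  exact (𝒢.finite_verts t).subset
    ((MultiGraph.ball_subset_ball 𝒢.limit_connected ht).trans (hr.ball_subset t))

end Infinite

section Agreement

variable {t : ℕ} {m R : ℝ} {x : V}

theorem mult_eq (hr : 𝒢.BallLike x₀ r) (hm : m ≤ r t)
    (hx : x ∈ 𝒢.limit.ball x₀ m \ 𝒢.limit.innerBoundary (𝒢.limit.ball x₀ m)) :
    (𝒢.graph t).mult x = 𝒢.limit.mult x := by
  have hball := MultiGraph.ball_mono (G := 𝒢.limit) x₀ hm
  funext y
  by_cases hy : y ∈ 𝒢.limit.ball x₀ m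
  · exact hr.ball_induced t x (hball hx.1) y (hball hy)
  · have hxy : 𝒢.limit.mult x y = 0 := by_contra fun hxy => hx.2 ⟨hx.1, y, hy, hxy⟩
    exact (Nat.le_zero.1 (hxy ▸ 𝒢.le_limit t x y)).trans hxy.symm

theorem degree_eq (hr : 𝒢.BallLike x₀ r) (hm : m ≤ r t)
    (hx : x ∈ 𝒢.limit.ball x₀ m \ 𝒢.limit.innerBoundary (𝒢.limit.ball x₀ m)) :
    (𝒢.graph t).degree x = 𝒢.limit.degree x := by
  simp only [MultiGraph.degree, hr.mult_eq hm hx]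

theorem step_eq (hr : 𝒢.BallLike x₀ r) (hm : m ≤ r t)
    (hx : x ∈ 𝒢.limit.ball x₀ m \ 𝒢.limit.innerBoundary (𝒢.limit.ball x₀ m)) :
    (𝒢.graph t).step x = 𝒢.limit.step x := by
  funext y
  simp only [MultiGraph.step, hr.mult_eq hm hx, hr.degree_eq hm hx]

theorem volume_ball_eq (hr : 𝒢.BallLike x₀ r) (hR : R + 1 ≤ r t) :
    (𝒢.graph t).volume (𝒢.limit.ball x₀ R) = 𝒢.limit.volume (𝒢.limit.ball x₀ R) :=
  finsum_mem_congr rfl fun _ hx => congrArg _ (hr.degree_eq le_rfl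
    ⟨MultiGraph.ball_mono x₀ (by linarith) hx,
      MultiGraph.notMem_innerBoundary_ball 𝒢.limit_connected hx hR⟩)

theorem ball_subset_verts (hr : 𝒢.BallLike x₀ r) (hR : R ≤ r t) :
    𝒢.limit.ball x₀ R ⊆ 𝒢.verts t :=
  (MultiGraph.ball_mono x₀ hR).trans (hr.ball_subset t)

theorem volume_ball_le_vol (hr : 𝒢.BallLike x₀ r) (hR : R + 1 ≤ r t) :
    𝒢.limit.volume (𝒢.limit.ball x₀ R) ≤ 𝒢.vol t := by
  rw [← hr.volume_ball_eq hR]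
  exact (𝒢.graph t).volume_mono (𝒢.finite_verts t) (hr.ball_subset_verts (by linarith))

theorem sum_transProb_mul_killed_le (hr : 𝒢.BallLike x₀ r) (h₀ : x₀ ∈ 𝒢.verts 0)
    (hm : m ≤ r t) {A : Finset V} (hA : (A : Set V) ⊆ 𝒢.limit.ball x₀ m) (k : ℕ) (y : V) :
    ∑ x ∈ A, 𝒢.transProb x₀ t x *
      𝒢.limit.killed (𝒢.limit.innerBoundary (𝒢.limit.ball x₀ m)) k x y ≤
        𝒢.transProb x₀ (t + k) y := by
  set B := 𝒢.limit.ball x₀ m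
  set S := 𝒢.limit.innerBoundary B
  have hBS : (B \ S).Finite := ((𝒢.finite_verts t).subset (hr.ball_subset_verts hm)).sdiff
  induction k generalizing y with
  | zero =>
    classical
    calc _ ≤ ∑ x ∈ A, if x = y then 𝒢.transProb x₀ t y else 0 :=
          Finset.sum_le_sum fun x _ => by
            have hP := transProb_nonneg (𝒢 := 𝒢) (x₀ := x₀) t y
            by_cases hxy : x = y <;> by_cases hyS : y ∈ S <;> simp [MultiGraph.killed, *]
      _ ≤ 𝒢.transProb x₀ (t + 0) y := by
          rw [Finset.sum_ite_eq']
          exact ite_le_sup _ _ _ |>.trans_eq (sup_of_le_left (transProb_nonneg _ _))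
  | succ k ih =>
    calc _ ≤ ∑ x ∈ A, 𝒢.transProb x₀ t x *
            ∑ z ∈ hBS.toFinset, 𝒢.limit.killed S k x z * 𝒢.limit.step z y :=
          Finset.sum_le_sum fun x hx => mul_le_mul_of_nonneg_left
            (MultiGraph.killed_succ_le hBS (hA hx)) (transProb_nonneg _ _)
      _ = ∑ z ∈ hBS.toFinset,
            (∑ x ∈ A, 𝒢.transProb x₀ t x * 𝒢.limit.killed S k x z) * 𝒢.limit.step z y := by
          simp only [Finset.mul_sum, Finset.sum_mul, mul_assoc]
          exact Finset.sum_comm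
      _ ≤ ∑ z ∈ hBS.toFinset, 𝒢.transProb x₀ (t + k) z * (𝒢.graph (t + k)).step z y :=
          Finset.sum_le_sum fun z hz => by
            have hmk : m ≤ r (t + k : ℕ) := hm.trans (hr.mono_nat (Nat.le_add_right t k))
            rw [hr.step_eq hmk (hBS.mem_toFinset.1 hz)]
            exact mul_le_mul_of_nonneg_right (ih z) (MultiGraph.step_nonneg _ _ _)
      _ ≤ 𝒢.transProb x₀ (t + (k + 1)) y := sum_transProb_mul_step_le h₀ (t + k) _ y

end Agreement

section HalfMass

variable {θ : ℝ}

theorem eventually_vol_sub_le (hr : 𝒢.BallLike x₀ r) [Infinite V] (h₀ : x₀ ∈ 𝒢.verts 0) {ε : ℝ}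
    (hε : 0 < ε)
    (hvol : ∀ᶠ R in Filter.atTop, (1 - ε) * 𝒢.limit.volume (𝒢.limit.ball x₀ R) ≤
      𝒢.limit.volume (𝒢.limit.ball x₀ (θ * R))) :
    ∀ᶠ t : ℕ in Filter.atTop,
      𝒢.vol t - 𝒢.limit.volume (𝒢.limit.ball x₀ (θ * r t)) ≤ 2 * ε * 𝒢.vol t := by
  filter_upwards [hr.eventually_vol_sub_lt h₀ hε, (hr.tendsto_radius h₀).eventually hvol]
    with t hball hsmaller
  have hv := vol_pos h₀ t
  have hnonneg := 𝒢.limit.volume_nonneg (𝒢.limit.ball x₀ (θ * r t))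
  rcases le_total ε 1 with hε1 | hε1
  · nlinarith [mul_le_mul_of_nonneg_left hball.le (sub_nonneg.2 hε1), mul_pos hε hv, sq_nonneg ε]
  · nlinarith

theorem eventually_half_le_sum_transProb (hr : 𝒢.BallLike x₀ r) [Infinite V]
    (h₀ : x₀ ∈ 𝒢.verts 0) {C : ℝ} (hC : 0 < C) (hθ : θ < 1)
    (henergy : ∀ᶠ t : ℕ in Filter.atTop, 𝒢.energy x₀ t ≤ C / 𝒢.vol t)
    (hvol : ∀ᶠ R in Filter.atTop, (1 - 1 / (8 * C)) * 𝒢.limit.volume (𝒢.limit.ball x₀ R) ≤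
      𝒢.limit.volume (𝒢.limit.ball x₀ (θ * R))) :
    ∀ᶠ t : ℕ in Filter.atTop,
      1 / 2 ≤ ∑ x ∈ (hr.ball_finite h₀ x₀ (θ * r t)).toFinset, 𝒢.transProb x₀ t x := by
  classical
  filter_upwards [henergy, hr.eventually_vol_sub_le h₀ (by positivity) hvol,
    (hr.tendsto_radius h₀).eventually_ge_atTop (1 / (1 - θ))] with t henergy hvol hrad
  have hθr : θ * r t + 1 ≤ r t := by
    rw [div_le_iff₀ (by linarith)] at hrad
    linarith
  set A := (hr.ball_finite h₀ x₀ (θ * r t)).toFinset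
  have hA : A ⊆ 𝒢.vertFinset t := fun x hx => 𝒢.mem_vertFinset.2
    (hr.ball_subset_verts (by linarith) ((Set.Finite.mem_toFinset _).1 hx))
  have hmass : ∑ x ∈ 𝒢.vertFinset t \ A, 𝒢.transProb x₀ t x + ∑ x ∈ A, 𝒢.transProb x₀ t x = 1 := by
    rw [Finset.sum_sdiff hA, sum_transProb h₀]
  have hdegree : ∑ x ∈ 𝒢.vertFinset t \ A, ((𝒢.graph t).degree x : ℝ) =
      𝒢.vol t - 𝒢.limit.volume (𝒢.limit.ball x₀ (θ * r t)) := by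
    rw [← hr.volume_ball_eq hθr, MultiGraph.volume_eq_sum _ (hr.ball_finite h₀ x₀ _), vol_eq_sum,
      eq_sub_iff_add_eq, Finset.sum_sdiff hA]
  have hsq : (∑ x ∈ 𝒢.vertFinset t \ A, 𝒢.transProb x₀ t x) ^ 2 ≤ (1 / 2) ^ 2 :=
    calc _ ≤ (∑ x ∈ 𝒢.vertFinset t \ A, ((𝒢.graph t).degree x : ℝ)) * 𝒢.energy x₀ t :=
          sq_sum_transProb_le t Finset.sdiff_subset
      _ ≤ (2 * (1 / (8 * C)) * 𝒢.vol t) * (C / 𝒢.vol t) :=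
          (mul_le_mul_of_nonneg_left henergy (by positivity)).trans
            (mul_le_mul_of_nonneg_right (hdegree.trans_le hvol)
              (div_nonneg hC.le (vol_pos h₀ t).le))
      _ = (1 / 2) ^ 2 := by
          have := (vol_pos h₀ t).ne'
          field_simp
          norm_num
  linarith [le_of_sq_le_sq hsq one_half_pos.le]

end HalfMass

section Reach

variable {ψ : ℝ → ℝ} {m T s : ℝ}

theorem genInv_spec (hr : 𝒢.BallLike x₀ r) [Infinite V] (h₀ : x₀ ∈ 𝒢.verts 0) (m : ℝ) :
    0 ≤ genInv r m ∧ m ≤ r (genInv r m) := by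
  obtain ⟨t, ht⟩ := ((hr.tendsto_radius h₀).eventually_ge_atTop m).exists
  have hclosed : IsClosed {s : ℝ | 0 ≤ s ∧ m ≤ r s} :=
    hr.continuousOn.preimage_isClosed_of_isClosed isClosed_Ici isClosed_Ici
  exact hclosed.csInf_mem ⟨t, t.cast_nonneg, ht⟩ ⟨0, fun _ h => h.1⟩

theorem genInv_mono (hr : 𝒢.BallLike x₀ r) [Infinite V] (h₀ : x₀ ∈ 𝒢.verts 0) :
    Monotone (genInv r) := fun _ m' h =>
  have hspec := hr.genInv_spec h₀ m'
  csInf_le ⟨0, fun _ h => h.1⟩ ⟨hspec.1, h.trans hspec.2⟩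

theorem reach_le (hr : 𝒢.BallLike x₀ r) [Infinite V] (h₀ : x₀ ∈ 𝒢.verts 0)
    (hψ : MonotoneOn ψ (Set.Ioi 0)) (hs : 0 ≤ s) (hm : 0 < m) (hmr : m ≤ r s) (hT : T ≤ s + ψ m) :
    reach r ψ T ≤ r s := by
  refine Real.sSup_le (fun m' ⟨hm', hm'T⟩ => ?_) (hr.pos s hs).le
  by_contra! hlt
  obtain ⟨hnonneg, hge⟩ := hr.genInv_spec h₀ m'
  have hgen : s < genInv r m' :=
    not_le.1 fun hle => (hlt.trans_le (hge.trans (hr.mono hnonneg hle))).false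
  have hψm : ψ m ≤ ψ m' := hψ hm hm' (hmr.trans hlt.le)
  linarith

theorem genInv_add_le_of_lt_reach (hr : 𝒢.BallLike x₀ r) [Infinite V] (h₀ : x₀ ∈ 𝒢.verts 0)
    (hψ : MonotoneOn ψ (Set.Ioi 0)) (hm : 0 < m) (hlt : m < reach r ψ T) :
    genInv r m + ψ m ≤ T := by
  have hne : {m : ℝ | 0 < m ∧ genInv r m + ψ m ≤ T}.Nonempty := by
    by_contra! hempty
    rw [reach, hempty, Real.sSup_empty] at hlt
    exact hm.not_gt hlt
  obtain ⟨m', ⟨hm', hm'T⟩, hmm'⟩ := exists_lt_of_lt_csSup hne hlt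
  exact (add_le_add (hr.genInv_mono h₀ hmm'.le) (hψ hm hm' hmm'.le)).trans hm'T

theorem le_radius_of_lt_reach (hr : 𝒢.BallLike x₀ r) [Infinite V] (h₀ : x₀ ∈ 𝒢.verts 0)
    (hψ : MonotoneOn ψ (Set.Ioi 0)) (hm : 0 < m) (hlt : m < reach r ψ T) :
    0 ≤ T - ψ m ∧ m ≤ r (T - ψ m) := by
  have hle := hr.genInv_add_le_of_lt_reach h₀ hψ hm hlt
  obtain ⟨hnonneg, hge⟩ := hr.genInv_spec h₀ m
  exact ⟨by linarith, hge.trans (hr.mono hnonneg (by linarith))⟩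

theorem reach_le_radius (hr : 𝒢.BallLike x₀ r) [Infinite V] (h₀ : x₀ ∈ 𝒢.verts 0)
    (hψc : ContinuousOn ψ (Set.Ioi 0)) (hψ : MonotoneOn ψ (Set.Ioi 0)) (hpos : 0 < reach r ψ T) :
    0 ≤ T - ψ (reach r ψ T) ∧ reach r ψ T ≤ r (T - ψ (reach r ψ T)) := by
  set M := reach r ψ T
  have hbelow : ∀ᶠ m in nhdsWithin M (Set.Iio M), 0 ≤ T - ψ m ∧ m ≤ r (T - ψ m) := by
    filter_upwards [Ioo_mem_nhdsLT hpos] with m hm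
    exact hr.le_radius_of_lt_reach h₀ hψ hm.1 hm.2
  have hlim : Filter.Tendsto (fun m => T - ψ m) (nhdsWithin M (Set.Iio M)) (nhds (T - ψ M)) :=
    (tendsto_const_nhds.sub
      (hψc.continuousAt (Ioi_mem_nhds hpos)).tendsto).mono_left nhdsWithin_le_nhds
  have hnonneg : 0 ≤ T - ψ M := ge_of_tendsto hlim (hbelow.mono fun _ h => h.1)
  have hlim' : Filter.Tendsto (fun m => r (T - ψ m)) (nhdsWithin M (Set.Iio M))
      (nhds (r (T - ψ M))) :=
    (hr.continuousOn _ hnonneg).tendsto.comp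
      (tendsto_nhdsWithin_iff.2 ⟨hlim, hbelow.mono fun _ h => h.1⟩)
  exact ⟨hnonneg, le_of_tendsto_of_tendsto (Filter.tendsto_id.mono_left nhdsWithin_le_nhds) hlim'
    (hbelow.mono fun _ h => h.2)⟩

theorem exists_add_eq (hr : 𝒢.BallLike x₀ r) (hψc : ContinuousOn ψ (Set.Ioi 0))
    (hψ₀ : ∀ m, 0 < m → 0 < ψ m) {a t : ℝ} (ha : 0 < a) (hT : 0 ≤ T)
    (ht : T + ψ (a * r T) ≤ t) : ∃ s ∈ Set.Icc T t, s + ψ (a * r s) = t := by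
  have hpos (s : ℝ) (hs : 0 ≤ s) : 0 < a * r s := mul_pos ha (hr.pos s hs)
  have hcont : ContinuousOn (fun s => s + ψ (a * r s)) (Set.Ici 0) :=
    continuousOn_id.add (hψc.comp (continuousOn_const.mul hr.continuousOn) hpos)
  have hTt : T ≤ t := by linarith [hψ₀ _ (hpos T hT)]
  exact intermediate_value_Icc hTt (hcont.mono fun s hs => hT.trans hs.1)
    ⟨ht, by linarith [hψ₀ _ (hpos t (hT.trans hTt))]⟩

end Reach

section LowerBound

variable {ψ cHK : ℝ → ℝ} {γ δ θ m : ℝ}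

theorem sum_transProb_mul_le (hr : 𝒢.BallLike x₀ r) (h₀ : x₀ ∈ 𝒢.verts 0)
    (hLLE : 𝒢.limit.LLE x₀ ψ cHK) (hδ : 0 < δ) (hδ' : δ < 1) (hδm : 1 ≤ δ * m) {s : ℕ}
    (hm : m ≤ r s) {A : Finset V} (hA : (A : Set V) ⊆ 𝒢.limit.ball x₀ ((1 - δ) * m)) {y : V}
    (hy : y ∈ 𝒢.limit.ball x₀ ((1 - δ) * m)) :
    (∑ x ∈ A, 𝒢.transProb x₀ s x) * (cHK δ / 𝒢.limit.volume (𝒢.limit.ball x₀ m)) ≤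
      𝒢.transProb x₀ (s + ⌊ψ m⌋₊) y := by
  rw [Finset.sum_mul]
  refine (Finset.sum_le_sum fun x hx => mul_le_mul_of_nonneg_left
    (hLLE.le_killed 𝒢.limit_connected hδ hδ' hδm (hA hx) hy) (transProb_nonneg s x)).trans ?_
  exact hr.sum_transProb_mul_killed_le h₀ hm
    (hA.trans (MultiGraph.ball_mono x₀ (by linarith))) _ y

theorem transProb_pos_of_dist_le (hr : 𝒢.BallLike x₀ r) [Infinite V] (h₀ : x₀ ∈ 𝒢.verts 0)
    (hγ : 0 < γ) (hlazy : 𝒢.Lazy γ) (hψc : ContinuousOn ψ (Set.Ioi 0))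
    (hψ : MonotoneOn ψ (Set.Ioi 0)) (hψ₀ : ∀ m, 0 < m → 0 < ψ m)
    (hLLE : 𝒢.limit.LLE x₀ ψ cHK) (hcHK : 0 < cHK (1 / 2)) (t : ℕ) {y : V}
    (hy : (𝒢.limit.toSimple.dist x₀ y : ℝ) ≤ 1 / 2 * reach r ψ t) :
    0 < 𝒢.transProb x₀ t y := by
  have hreturn (s : ℕ) : 0 < 𝒢.transProb x₀ s x₀ :=
    transProb_pos_of_le h₀ hγ hlazy s.zero_le (by simp [transProb])
  rcases Nat.eq_zero_or_pos (𝒢.limit.toSimple.dist x₀ y) with hdist | hdist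
  · exact 𝒢.limit_connected.dist_eq_zero_iff.1 hdist ▸ hreturn t
  have hdist : (1 : ℝ) ≤ 𝒢.limit.toSimple.dist x₀ y := by exact_mod_cast hdist
  obtain ⟨hnonneg, hle⟩ := hr.reach_le_radius h₀ hψc hψ (T := t) (by linarith)
  set M := reach r ψ t
  have hfloor : (⌊ψ M⌋₊ : ℝ) ≤ ψ M := Nat.floor_le (hψ₀ M (by linarith)).le
  have hfloor_le : ⌊ψ M⌋₊ ≤ t := by exact_mod_cast hfloor.trans (sub_nonneg.1 hnonneg)
  have hM : M ≤ r (t - ⌊ψ M⌋₊ : ℕ) := by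
    rw [Nat.cast_sub hfloor_le]
    exact hle.trans (hr.mono hnonneg (by linarith))
  have hv : 0 < 𝒢.limit.volume (𝒢.limit.ball x₀ M) := MultiGraph.volume_ball_pos
    (hr.ball_finite h₀ x₀ M) (𝒢.limit_degree_pos x₀) (by linarith)
  have hbound := hr.sum_transProb_mul_le h₀ hLLE (A := {x₀}) (y := y) one_half_pos one_half_lt_one
    (by linarith) hM (by simpa using MultiGraph.mem_ball_self x₀ (by linarith))
    (by rw [MultiGraph.mem_ball]; linarith)
  rw [Finset.sum_singleton, Nat.sub_add_cancel hfloor_le] at hbound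
  exact (mul_pos (hreturn _) (div_pos hcHK hv)).trans_le hbound

theorem div_vol_le_transProb_of_add_eq (hr : 𝒢.BallLike x₀ r) [Infinite V] (h₀ : x₀ ∈ 𝒢.verts 0)
    (hγ : 0 ≤ γ) (hlazy : 𝒢.Lazy γ) (hLLE : 𝒢.limit.LLE x₀ ψ cHK) (hcHK : 0 ≤ cHK δ)
    (hδ : 0 < δ) (hδ' : δ < 1) (hδm : 1 ≤ δ * m) {s : ℝ} (hs : 0 ≤ s) (hms : m + 1 ≤ r s)
    {t : ℕ} (hψm : 0 ≤ ψ m) (hst : s + ψ m = t) {A : Finset V}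
    (hA : (A : Set V) ⊆ 𝒢.limit.ball x₀ ((1 - δ) * m))
    (hmass : 1 / 2 ≤ ∑ x ∈ A, 𝒢.transProb x₀ ⌊s⌋₊ x) {y : V}
    (hy : y ∈ 𝒢.limit.ball x₀ ((1 - δ) * m)) :
    γ * cHK δ / 2 / 𝒢.vol t ≤ 𝒢.transProb x₀ t y := by
  have htime : ⌈s⌉₊ + ⌊ψ m⌋₊ = t := by
    have hceil : ⌈s⌉₊ ≤ t := Nat.ceil_le.2 (by linarith)
    have hfloor : ⌊ψ m⌋₊ = t - ⌈s⌉₊ := by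
      rw [Nat.floor_eq_iff hψm, Nat.cast_sub hceil]
      constructor <;> linarith [Nat.le_ceil s, Nat.ceil_lt_add_one hs]
    omega
  have hv : 0 < 𝒢.limit.volume (𝒢.limit.ball x₀ m) := MultiGraph.volume_ball_pos
    (hr.ball_finite h₀ x₀ m) (𝒢.limit_degree_pos x₀) (by nlinarith)
  have hvt : 𝒢.limit.volume (𝒢.limit.ball x₀ m) ≤ 𝒢.vol t :=
    hr.volume_ball_le_vol (hms.trans (hr.mono hs (by linarith)))
  have hmass' : γ / 2 ≤ ∑ x ∈ A, 𝒢.transProb x₀ ⌈s⌉₊ x :=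
    calc γ / 2 = γ * (1 / 2) := by ring
      _ ≤ ∑ x ∈ A, γ * 𝒢.transProb x₀ ⌊s⌋₊ x :=
        (mul_le_mul_of_nonneg_left hmass hγ).trans_eq (Finset.mul_sum _ _ _)
      _ ≤ _ := Finset.sum_le_sum fun x _ => mul_transProb_floor_le_ceil h₀ hlazy s x
  calc γ * cHK δ / 2 / 𝒢.vol t
      ≤ γ * cHK δ / 2 / 𝒢.limit.volume (𝒢.limit.ball x₀ m) :=
        div_le_div_of_nonneg_left (by positivity) hv hvt
    _ = γ / 2 * (cHK δ / 𝒢.limit.volume (𝒢.limit.ball x₀ m)) := by ring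
    _ ≤ (∑ x ∈ A, 𝒢.transProb x₀ ⌈s⌉₊ x) * (cHK δ / 𝒢.limit.volume (𝒢.limit.ball x₀ m)) :=
        mul_le_mul_of_nonneg_right hmass' (by positivity)
    _ ≤ 𝒢.transProb x₀ (⌈s⌉₊ + ⌊ψ m⌋₊) y :=
        hr.sum_transProb_mul_le h₀ hLLE hδ hδ' hδm
          ((le_add_of_nonneg_right zero_le_one).trans
            (hms.trans (hr.mono hs (Nat.le_ceil s)))) hA hy
    _ = 𝒢.transProb x₀ t y := by rw [htime]

theorem eventually_div_vol_le_transProb (hr : 𝒢.BallLike x₀ r) [Infinite V] (h₀ : x₀ ∈ 𝒢.verts 0)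
    (hγ : 0 ≤ γ) (hlazy : 𝒢.Lazy γ) (hψc : ContinuousOn ψ (Set.Ioi 0))
    (hψ : MonotoneOn ψ (Set.Ioi 0)) (hψ₀ : ∀ m, 0 < m → 0 < ψ m) (hLLE : 𝒢.limit.LLE x₀ ψ cHK)
    (hcHK : 0 ≤ cHK δ) (hδ : 0 < δ) (hδ' : δ < 1) (hθ : θ ≤ (1 - δ) ^ 2)
    (hmass : ∀ᶠ t : ℕ in Filter.atTop,
      1 / 2 ≤ ∑ x ∈ (hr.ball_finite h₀ x₀ (θ * r t)).toFinset, 𝒢.transProb x₀ t x) :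
    ∀ᶠ t : ℕ in Filter.atTop, ∀ y,
      (𝒢.limit.toSimple.dist x₀ y : ℝ) ≤ (1 - δ) ^ 2 * reach r ψ t →
        γ * cHK δ / 2 / 𝒢.vol t ≤ 𝒢.transProb x₀ t y := by
  obtain ⟨T, hT⟩ := Filter.eventually_atTop.1 (hmass.and
    ((hr.tendsto_radius h₀).eventually_ge_atTop (1 / (δ * (1 - δ)))))
  filter_upwards [tendsto_natCast_atTop_atTop.eventually_ge_atTop (T + ψ ((1 - δ) * r T))]
    with t ht y hy
  obtain ⟨s, hsT, hst⟩ := hr.exists_add_eq hψc hψ₀ (sub_pos.2 hδ') T.cast_nonneg ht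
  have hs : 0 ≤ s := T.cast_nonneg.trans hsT.1
  obtain ⟨hmass, hrad⟩ := hT ⌊s⌋₊ (Nat.le_floor hsT.1)
  have hrs : r ⌊s⌋₊ ≤ r s := hr.mono (Nat.cast_nonneg _) (Nat.floor_le hs)
  have hr₀ : 0 < r ⌊s⌋₊ := hr.pos _ (Nat.cast_nonneg _)
  set m := (1 - δ) * r s with hm
  have hm₀ : 0 < m := mul_pos (sub_pos.2 hδ') (hr₀.trans_le hrs)
  have hδm : 1 ≤ δ * m := by
    rw [hm, ← mul_assoc, mul_comm, ← div_le_iff₀ (mul_pos hδ (sub_pos.2 hδ'))]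
    exact hrad.trans hrs
  have hms : m + 1 ≤ r s := by nlinarith
  have hA : (((hr.ball_finite h₀ x₀ (θ * r ⌊s⌋₊)).toFinset : Finset V) : Set V) ⊆
      𝒢.limit.ball x₀ ((1 - δ) * m) := by
    rw [Set.Finite.coe_toFinset, hm, ← mul_assoc, ← sq]
    exact MultiGraph.ball_mono x₀ (mul_le_mul hθ hrs hr₀.le (sq_nonneg _))
  have hreach : reach r ψ t ≤ r s := hr.reach_le h₀ hψ hs hm₀ (by linarith) hst.ge
  have hy' : y ∈ 𝒢.limit.ball x₀ ((1 - δ) * m) := by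
    rw [MultiGraph.mem_ball, hm, ← mul_assoc, ← sq]
    exact hy.trans (mul_le_mul_of_nonneg_left hreach (sq_nonneg _))
  exact hr.div_vol_le_transProb_of_add_eq h₀ hγ hlazy hLLE hcHK hδ hδ' hδm hs hms (hψ₀ m hm₀).le
    hst hA hmass hy'

end LowerBound

end BallLike

section Recurrence

open MeasureTheory

theorem exists_pos_forall_div_vol_le (h₀ : x₀ ∈ 𝒢.verts 0) {Q : ℕ → V → Prop} {c : ℝ} (hc : 0 < c)
    (hpos : ∀ t y, Q t y → 0 < 𝒢.transProb x₀ t y)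
    (hev : ∀ᶠ t in Filter.atTop, ∀ y, Q t y → c / 𝒢.vol t ≤ 𝒢.transProb x₀ t y) :
    ∃ c' > 0, ∀ t y, Q t y → c' / 𝒢.vol t ≤ 𝒢.transProb x₀ t y := by
  obtain ⟨T, hT⟩ := Filter.eventually_atTop.1 hev
  have hsmall : ∀ᶠ c' in nhdsWithin (0 : ℝ) (Set.Ioi 0), ∀ t ∈ Finset.range T,
      ∀ y ∈ 𝒢.vertFinset t, Q t y → c' < 𝒢.transProb x₀ t y * 𝒢.vol t := by
    simp only [Filter.eventually_all_finset, Filter.eventually_imp_distrib_left]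
    intro t _ y _ hy
    filter_upwards [Ioo_mem_nhdsGT (mul_pos (hpos t y hy) (vol_pos h₀ t))] with c' hc'
    exact hc'.2
  obtain ⟨c', hc', hlt⟩ := (Filter.Eventually.and (Ioo_mem_nhdsGT hc) hsmall).exists
  refine ⟨c', hc'.1, fun t y hy => ?_⟩
  rcases lt_or_ge t T with ht | ht
  · have hyt : y ∈ 𝒢.verts t := mem_verts_of_transProb_ne_zero h₀ (hpos t y hy).ne'
    exact (div_le_iff₀ (vol_pos h₀ t)).2
      (hlt t (Finset.mem_range.2 ht) y (𝒢.mem_vertFinset.2 hyt) hy).le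
  · exact (div_le_div_of_nonneg_right hc'.2.le (vol_pos h₀ t).le).trans (hT t ht y hy)

theorem not_summable_transProb (h₀ : x₀ ∈ 𝒢.verts 0) {c : ℝ} (hc : 0 < c)
    (hle : ∀ t, c / 𝒢.vol t ≤ 𝒢.transProb x₀ t x₀) (hvol : ¬Summable fun t => 1 / 𝒢.vol t) :
    ¬Summable fun t => 𝒢.transProb x₀ t x₀ := fun hsum =>
  hvol <| (hsum.mul_left c⁻¹).of_nonneg_of_le (fun t => (one_div_pos.2 (vol_pos h₀ t)).le)
    fun t => (le_inv_mul_iff₀ hc).2 ((mul_one_div c _).trans_le (hle t))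

variable {Ω : Type*} [MeasurableSpace Ω] {μ : Measure Ω} {X : ℕ → Ω → V}

theorem IsWalk.measurableSet_eq (hX : 𝒢.IsWalk x₀ μ X) (t : ℕ) (y : V) :
    MeasurableSet {ω | X t ω = y} :=
  hX.measurable t (MeasurableSpace.measurableSet_top (s := {y}))

theorem IsWalk.measure_inter_succ (hX : 𝒢.IsWalk x₀ μ X) {t : ℕ} {x : V} (hx : x ∈ 𝒢.verts t)
    (y : V) : μ ({ω | X t ω = x} ∩ {ω | X (t + 1) ω = y}) =
      μ {ω | X t ω = x} * ENNReal.ofReal ((𝒢.graph t).step x y) := by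
  simpa using hX.markov t Set.univ MeasurableSet.univ x hx y

theorem IsWalk.ofReal_transProb_le [IsProbabilityMeasure μ] (hX : 𝒢.IsWalk x₀ μ X)
    (h₀ : x₀ ∈ 𝒢.verts 0) (t : ℕ) (y : V) :
    ENNReal.ofReal (𝒢.transProb x₀ t y) ≤ μ {ω | X t ω = y} := by
  induction t generalizing y with
  | zero =>
    by_cases h : y = x₀
    · rw [h, (mem_ae_iff_prob_eq_one (hX.measurableSet_eq 0 x₀)).1 hX.start]
      simp [transProb]
    · simp [transProb, h]
  | succ t ih =>
    calc ENNReal.ofReal (𝒢.transProb x₀ (t + 1) y)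
        = ∑ z ∈ 𝒢.vertFinset t,
            ENNReal.ofReal (𝒢.transProb x₀ t z) * ENNReal.ofReal ((𝒢.graph t).step z y) := by
          rw [transProb_succ h₀ subset_rfl y, ENNReal.ofReal_sum_of_nonneg fun z _ =>
            mul_nonneg (transProb_nonneg t z) ((𝒢.graph t).step_nonneg z y)]
          simp only [ENNReal.ofReal_mul (transProb_nonneg t _)]
      _ ≤ ∑ z ∈ 𝒢.vertFinset t, μ ({ω | X t ω = z} ∩ {ω | X (t + 1) ω = y}) :=
          Finset.sum_le_sum fun z hz => by
            rw [hX.measure_inter_succ (𝒢.mem_vertFinset.1 hz)]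
            exact mul_le_mul_left (ih z) _
      _ = μ (⋃ z ∈ 𝒢.vertFinset t, {ω | X t ω = z} ∩ {ω | X (t + 1) ω = y}) :=
          (measure_biUnion_finset
            (fun z _ w _ hzw => Set.disjoint_left.2 fun ω hz hw => hzw (hz.1.symm.trans hw.1))
            fun z _ => (hX.measurableSet_eq t z).inter (hX.measurableSet_eq (t + 1) y)).symm
      _ ≤ μ {ω | X (t + 1) ω = y} :=
          measure_mono (Set.iUnion₂_subset fun _ _ => Set.inter_subset_right)

theorem IsWalk.weaklyRecurrent [IsProbabilityMeasure μ] (hX : 𝒢.IsWalk x₀ μ X)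
    (h₀ : x₀ ∈ 𝒢.verts 0) (hsum : ¬Summable fun t => 𝒢.transProb x₀ t x₀) :
    WeaklyRecurrent μ X x₀ := by
  have hvisits : ∫⁻ ω, ∑' t : ℕ, Set.indicator {ω' | X t ω' = x₀} (fun _ => (1 : ENNReal)) ω ∂μ =
      ∑' t, μ {ω | X t ω = x₀} := by
    rw [lintegral_tsum fun t =>
      (measurable_const.indicator (hX.measurableSet_eq t x₀)).aemeasurable]
    simp only [lintegral_indicator_const (hX.measurableSet_eq _ x₀), one_mul]
  by_contra hne
  rw [WeaklyRecurrent, hvisits] at hne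
  have hle : ∑' t, ENNReal.ofReal (𝒢.transProb x₀ t x₀) ≤ ∑' t, μ {ω | X t ω = x₀} :=
    ENNReal.tsum_le_tsum fun t => hX.ofReal_transProb_le h₀ t x₀
  exact hsum ((ENNReal.summable_toReal (ne_top_of_le_ne_top hne hle)).congr fun t =>
    ENNReal.toReal_ofReal (transProb_nonneg t x₀))

end Recurrence

end GrowingGraph

theorem exists_le_one_sub_sq {a : ℝ} (ha : a < 1) : ∃ δ, 0 < δ ∧ δ < 1 ∧ a ≤ (1 - δ) ^ 2 := by
  rcases le_total a 0 with h | h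
  · exact ⟨1 / 2, by norm_num, by norm_num, h.trans (sq_nonneg _)⟩
  · exact ⟨(1 - a) / 2, by linarith, by linarith, by nlinarith [sq_nonneg (1 - a)]⟩

theorem proposition1p13_general (γ ζ D₁ D₂ δ₀ : ℝ) (hγ : 0 < γ) (hζ : 0 < ζ) (hδ₀ : 0 < δ₀)
    (cHK : ℝ → ℝ) (hcHK : ∀ δ, 0 < δ → δ < 1 → 0 < cHK δ) :
    ∃ c : ℝ, 0 < c ∧
      ∀ (V : Type*) [Infinite V] (𝒢 : GrowingGraph V) (x₀ : V) (r ψ : ℝ → ℝ),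
        x₀ ∈ 𝒢.verts 0 →
        𝒢.Lazy γ →
        𝒢.limit.VolumeDoubling D₁ →
        ContinuousOn ψ (Set.Ioi 0) → MonotoneOn ψ (Set.Ioi 0) → (∀ m, 0 < m → 0 < ψ m) →
        𝒢.limit.LLE x₀ ψ cHK →
        𝒢.BallLike x₀ r →
        𝒢.Regular ζ →
        𝒢.VolDoubling D₂ →
        (∀ᶠ t : ℕ in Filter.atTop, ∀ y,
          (𝒢.limit.toSimple.dist x₀ y : ℝ) ≤ (1 - δ₀) * reach r ψ t →
            c / 𝒢.vol t ≤ 𝒢.transProb x₀ t y) ∧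
        (∃ c' > 0, ∀ (t : ℕ) y,
          (𝒢.limit.toSimple.dist x₀ y : ℝ) ≤ 1 / 2 * reach r ψ t →
            c' / 𝒢.vol t ≤ 𝒢.transProb x₀ t y) ∧
        ((¬ Summable fun t : ℕ => 1 / 𝒢.vol t) →
          ∀ (Ω : Type*) [MeasurableSpace Ω] (μ : MeasureTheory.Measure Ω)
            [MeasureTheory.IsProbabilityMeasure μ] (X : ℕ → Ω → V),
            𝒢.IsWalk x₀ μ X → WeaklyRecurrent μ X x₀) := by
  have hC := GrowingGraph.decayConst_pos γ ζ (lt_max_of_lt_right one_pos : 0 < max D₂ 1)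
  set C := GrowingGraph.decayConst γ ζ (max D₂ 1)
  obtain ⟨θ, hθ, hvol⟩ := MultiGraph.exists_volume_ball_ge D₁ (ε := 1 / (8 * C)) (by positivity)
  obtain ⟨δ, hδ, hδ', hle⟩ := exists_le_one_sub_sq
    (max_lt hθ (max_lt (sub_lt_self 1 hδ₀) one_half_lt_one))
  simp only [max_le_iff] at hle
  have hc : 0 < γ * cHK δ / 2 := by have := hcHK δ hδ hδ'; positivity
  refine ⟨_, hc, fun V _ 𝒢 x₀ r ψ h₀ hlazy hD₁ hψc hψ hψ₀ hLLE hr hreg hD₂ => ?_⟩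
  have hreach (t : ℕ) : 0 ≤ reach r ψ t := Real.sSup_nonneg fun _ h => h.1.le
  have hmass := hr.eventually_half_le_sum_transProb h₀ hC hθ
    (GrowingGraph.eventually_energy_le h₀ hγ hζ hlazy hreg (hD₂.mono h₀ (le_max_left _ _)))
    (hvol V 𝒢.limit 𝒢.limit_connected (hr.ball_finite h₀) 𝒢.limit_degree_pos hD₁ x₀)
  have hlower := hr.eventually_div_vol_le_transProb h₀ hγ.le hlazy hψc hψ hψ₀ hLLE
    (hcHK δ hδ hδ').le hδ hδ' hle.1 hmass
  obtain ⟨c', hc', hall⟩ := GrowingGraph.exists_pos_forall_div_vol_le h₀ hc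
    (fun t y => hr.transProb_pos_of_dist_le h₀ hγ hlazy hψc hψ hψ₀ hLLE
      (hcHK _ one_half_pos one_half_lt_one) t)
    (hlower.mono fun t h y hy => h y (hy.trans (mul_le_mul_of_nonneg_right hle.2.2 (hreach t))))
  refine ⟨hlower.mono fun t h y hy =>
    h y (hy.trans (mul_le_mul_of_nonneg_right hle.2.1 (hreach t))), ⟨c', hc', hall⟩, ?_⟩
  intro hdiv Ω _ μ _ X hX
  exact hX.weaklyRecurrent h₀ (GrowingGraph.not_summable_transProb h₀ hc'
    (fun t => hall t x₀ (by simpa using hreach t)) hdiv)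

theorem proposition1p13 (γ Δ ζ D₁ D₂ : ℝ) (hγ : 0 < γ) (hγ' : γ ≤ 1 / 2) (hζ : 0 < ζ) :
    ∃ δ₀ : ℝ, 0 < δ₀ ∧ δ₀ ≤ 1 / 2 ∧
      ∀ cHK : ℝ → ℝ, (∀ δ, 0 < δ → δ < 1 → 0 < cHK δ) →
      ∃ c : ℝ, 0 < c ∧
        ∀ (V : Type*) [Infinite V] (𝒢 : GrowingGraph V) (x₀ : V) (r ψ : ℝ → ℝ),
          x₀ ∈ 𝒢.verts 0 →
          𝒢.Lazy γ →
          𝒢.DegreeBound Δ →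
          𝒢.limit.VolumeDoubling D₁ →
          ContinuousOn ψ (Set.Ioi 0) → MonotoneOn ψ (Set.Ioi 0) → (∀ m, 0 < m → 0 < ψ m) →
          𝒢.limit.LLE x₀ ψ cHK →
          𝒢.BallLike x₀ r →
          𝒢.Regular ζ →
          𝒢.VolDoubling D₂ →
          (∃ t₀ : ℕ, ∀ t : ℕ, t₀ ≤ t → ∀ y ∈ 𝒢.verts t,
            (𝒢.limit.toSimple.dist x₀ y : ℝ) ≤ (1 - δ₀) * reach r ψ t →
              c / 𝒢.vol t ≤ 𝒢.transProb x₀ t y) ∧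
          (∃ c' : ℝ, 0 < c' ∧ ∀ t : ℕ, 2 ≤ t → ∀ y ∈ 𝒢.verts t,
            (𝒢.limit.toSimple.dist x₀ y : ℝ) ≤ (1 - δ₀) * reach r ψ t →
              c' / 𝒢.vol t ≤ 𝒢.transProb x₀ t y) ∧
          ((¬ Summable fun t : ℕ => 1 / 𝒢.vol t) →
            ∀ (Ω : Type*) [MeasurableSpace Ω] (μ : MeasureTheory.Measure Ω)
              [MeasureTheory.IsProbabilityMeasure μ] (X : ℕ → Ω → V),
              𝒢.IsWalk x₀ μ X → WeaklyRecurrent μ X x₀) := by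
  refine ⟨1 / 2, one_half_pos, le_rfl, fun cHK hcHK => ?_⟩
  obtain ⟨c, hc, h⟩ := proposition1p13_general γ ζ D₁ D₂ (1 / 2) hγ hζ one_half_pos cHK hcHK
  refine ⟨c, hc, fun V _ 𝒢 x₀ r ψ h₀ hlazy _ hD₁ hψc hψ hψ₀ hLLE hr hreg hD₂ => ?_⟩
  obtain ⟨hlarge, ⟨c', hc', hall⟩, hrec⟩ :=
    h V 𝒢 x₀ r ψ h₀ hlazy hD₁ hψc hψ hψ₀ hLLE hr hreg hD₂
  obtain ⟨t₀, ht₀⟩ := Filter.eventually_atTop.1 hlarge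
  exact ⟨⟨t₀, fun t ht y _ => ht₀ t ht y⟩,
    ⟨c', hc', fun t _ y _ hy => hall t y (by rwa [sub_half] at hy)⟩, hrec⟩
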